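/- **Theorem 2.4.** Let $\beta>0$, $b_0>0$. For $n\ge 1$ let $h(x)=e^{-\beta|x|^2}$ be the Gaussian on $\mathbb R^n$, let $\alpha_n$ be the volume of the unit ball of $\mathbb R^n$, and put $\rho=\sqrt3/e$, $\rho_3=12^{1/4}\sqrt{e\beta}$, $$\Delta''=\begin{cases}\sqrt{2+\tfrac1e}\;\pi^{\frac{n-1}4}(n\alpha_n)^{\frac12}2^{\frac n4}\rho^{\frac{n-1}4}& n\text{ odd},\\ \pi^{\frac{n-1}4}(n\alpha_n)^{\frac12}2^{\frac{n+1}4}\rho^{\frac{n-2}4}& n\text{ even},\end{cases}$$ $$c_1=\frac{\Delta''}{\sqrt{16\pi}\sqrt{b_0}},\qquad c_2=\rho_3^4\cdot3^3\cdot2^7\cdot b_0^3,\qquad c_3=\frac{b_0}4,\qquad \delta_0=\min\Big\{b_0,\frac1{\rho_3^4\cdot3^3\cdot2^7\cdot b_0^3}\Big\}.$$ These are positive numbers, and $c_2,c_3,\delta_0$ do not depend on $n$. For an integer $m\ge0$ let $\mathcal D_m$ be the set of compactly supported $C^\infty$ functions $\varphi:\mathbb R^n\to\mathbb C$ with $\int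 x^\alpha\varphi(x)\,dx=0$ for all $|\alpha|<m$. The native space $\mathcal C_{h,m}$ consists of the continuous $f:\mathbb R^n\to\mathbb C$ for which there is a constant $c\ge0$ with $$\Big|\int f\varphi\,dx\Big|\le c\Big\{\iint h(x-y)\varphi(x)\overline{\varphi(y)}\,dx\,dy\Big\}^{1/2}\quad\text{for all }\varphi\in\mathcal D_m,$$ and $\|f\|_h$ is the smallest such $c$. For a finite set $X\subset\mathbb R^n$, an $h$-spline interpolating $f$ on $X$ is a function $s(x)=p(x)+\sum_{y\in X}c_y\,h(x-y)$, where $p$ is a polynomial of degree at most $m-1$ ($p=0$ if $m=0$) and the $c_y\in\mathbb C$ satisfy $\sum_{y\in X}c_y q(y)=0$ for all polynomials $q$ of degree at most $m-1$, such that $s=f$ on $X$. The equally spaced points of degree $d\ge1$ on an $n$-simplex $Q$ are the points of $Q$ with barycentric coordinates $(k_1/d,\dots,k_{n+1}/d)$, where the $k_i$ are nonnegative integers with sum $d$. Let $m\ge 0$, $f\in\mathcal C_{h,m}$, let $X\subset\mathbb R^n$ be finite, and let $s$ be an $h$-spline interpolating $f$ on $X$. Let $0<\delta\le\delta_0$ be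 such that $m\le 2b_0/\delta$, and $n-3\le 2b_0/\delta$ if $n$ is odd, $n-4\le 2b_0/\delta$ if $n$ is even. Let $\Omega\subseteq\mathbb R^n$, and let $x\in\Omega$ be a point with the following property: there are a number $r$ with $b_0/2\le r\le b_0$ and an $n$-simplex $Q$ of diameter $r$ with $x\in Q\subseteq\Omega$, such that, for every integer $l\ge2$ with $b_0/\delta\le l\le 2b_0/\delta$, $X$ contains the equally spaced points of degree $l-1$ on $Q$. Then $$|f(x)-s(x)|\le c_1\sqrt\delta\,(c_2\delta)^{c_3/\delta}\,\|f\|_h .$$ In particular, this bound holds for all $x\in\Omega$ if every point of $\Omega$ has this property. -/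

import Mathlib

open MeasureTheory
open scoped ContDiff ComplexConjugate

noncomputable section

namespace GaussianInterpolation

/-- The space `R^n` with its Euclidean norm. -/
abbrev Space (n : ℕ) : Type := EuclideanSpace ℝ (Fin n)

/-- The Gaussian `x ↦ exp (-β |x|²)` on `R^n`. -/
def gaussian (n : ℕ) (β : ℝ) (x : Space n) : ℝ := Real.exp (-β * ‖x‖ ^ 2)

/-! ### Polynomials and the spline interpolant -/

/-- `q` is a complex polynomial in `n` variables, all of whose monomials have total degree `< m`,
that is, of degree at most `m - 1`; for `m = 0` only `q = 0` qualifies. -/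
def PolyDegreeLT {n : ℕ} (m : ℕ) (q : MvPolynomial (Fin n) ℂ) : Prop :=
  ∀ a ∈ q.support, ∑ i, a i < m

/-- The value of a complex polynomial at a point of `R^n`. -/
def polyEval {n : ℕ} (q : MvPolynomial (Fin n) ℂ) (x : Space n) : ℂ :=
  MvPolynomial.eval (fun i => (x i : ℂ)) q

/-- `s` is an `h`-spline (for the order `m`) that interpolates `f` on the finite set `X`:
`s x = p x + ∑ c_j h (x - x_j)` with `p` of degree at most `m - 1`, the coefficients `c_j`
annihilate all polynomials of degree at most `m - 1`, and `s = f` on `X`. -/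
def IsSplineInterpolant {n : ℕ} (h : Space n → ℝ) (m : ℕ) (X : Finset (Space n))
    (f s : Space n → ℂ) : Prop :=
  ∃ (p : MvPolynomial (Fin n) ℂ) (c : Space n → ℂ),
    PolyDegreeLT m p ∧
    (∀ q : MvPolynomial (Fin n) ℂ, PolyDegreeLT m q → ∑ y ∈ X, c y * polyEval q y = 0) ∧
    (∀ x, s x = polyEval p x + ∑ y ∈ X, c y * (h (x - y) : ℂ)) ∧
    ∀ y ∈ X, s y = f y

/-! ### The native space -/

/-- The space `𝒟_m`: complex-valued compactly supported smooth functions on `R^n` whose moments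
of order `< m` vanish. -/
def IsTestFunction {n : ℕ} (m : ℕ) (φ : Space n → ℂ) : Prop :=
  ContDiff ℝ ∞ φ ∧ HasCompactSupport φ ∧
    ∀ α : Fin n → ℕ, ∑ i, α i < m → ∫ x, (∏ i, (x i : ℂ) ^ α i) * φ x = 0

/-- The double integral `∫∫ h (x - y) φ x conj (φ y) dx dy`. For conditionally positive definite
`h` of order `m` and `φ ∈ 𝒟_m` it is real and nonnegative; we take its real part. -/
def energy {n : ℕ} (h : Space n → ℝ) (φ : Space n → ℂ) : ℝ :=
  (∫ x, ∫ y, (h (x - y) : ℂ) * φ x * conj (φ y)).re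

/-- `C ≥ 0` is an admissible constant in the inequality that defines the native space. -/
def IsNativeBound {n : ℕ} (h : Space n → ℝ) (m : ℕ) (f : Space n → ℂ) (C : ℝ) : Prop :=
  0 ≤ C ∧ ∀ φ : Space n → ℂ, IsTestFunction m φ → ‖∫ x, f x * φ x‖ ≤ C * √(energy h φ)

/-- Membership in the native space `C_{h,m}` of Madych and Nelson. -/
def InNativeSpace {n : ℕ} (h : Space n → ℝ) (m : ℕ) (f : Space n → ℂ) : Prop :=
  Continuous f ∧ ∃ C, IsNativeBound h m f C

/-- The `h`-norm of `f`: the smallest admissible constant. -/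
def nativeNorm {n : ℕ} (h : Space n → ℝ) (m : ℕ) (f : Space n → ℂ) : ℝ :=
  sInf {C | IsNativeBound h m f C}

/-! ### Simplices and equally spaced centers -/

/-- The (closed, solid) `n`-simplex with the given affinely independent vertices. -/
def solid {n : ℕ} (S : Affine.Simplex ℝ (Space n) n) : Set (Space n) :=
  convexHull ℝ (Set.range S.points)

/-- The equally spaced points of degree `d` (`d ≥ 1`) of a simplex: those with barycentric
coordinates `(k_1 / d, …, k_{n+1} / d)`, the `k_i` being nonnegative integers with sum `d`. -/
def equallySpaced {n : ℕ} (S : Affine.Simplex ℝ (Space n) n) (d : ℕ) : Set (Space n) :=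
  {x | ∃ k : Fin (n + 1) → ℕ, ∑ i, k i = d ∧ x = ∑ i, ((k i : ℝ) / (d : ℝ)) • S.points i}

/-- The condition on `Ω` and the centers `X` at the point `x`: some `n`-simplex `Q` of diameter
`r ∈ [b₀ / 2, b₀]` satisfies `x ∈ Q ⊆ Ω`, and `X` contains the equally spaced points of degree
`l - 1` of `Q` for all integers `l` with `b₀ / δ ≤ l ≤ 2 b₀ / δ` (and `l ≥ 2`, so that the
degree is positive). -/
def HasCentersAt {n : ℕ} (X : Finset (Space n)) (b₀ δ : ℝ) (Ω : Set (Space n)) (x : Space n) :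
    Prop :=
  ∃ r : ℝ, b₀ / 2 ≤ r ∧ r ≤ b₀ ∧
    ∃ S : Affine.Simplex ℝ (Space n) n,
      Metric.diam (solid S) = r ∧ x ∈ solid S ∧ solid S ⊆ Ω ∧
      ∀ l : ℕ, 2 ≤ l → b₀ / δ ≤ (l : ℝ) → (l : ℝ) ≤ 2 * b₀ / δ →
        equallySpaced S (l - 1) ⊆ (X : Set (Space n))

/-! ### The constants -/

/-- `ρ = √3 / e`. -/
def rho : ℝ := √3 / Real.exp 1

/-- `ρ₃ = 12^{1/4} √(e β)`. -/
def rho3 (β : ℝ) : ℝ := (12 : ℝ) ^ (1 / 4 : ℝ) * √(Real.exp 1 * β)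

/-- The volume of the unit ball of `R^n`. -/
def unitBallVolume (n : ℕ) : ℝ := (volume : Measure (Space n)).real (Metric.ball 0 1)

open scoped Classical in
/-- The constant `Δ''`. -/
def Delta (n : ℕ) : ℝ :=
  if Odd n then
    √(2 + 1 / Real.exp 1) * Real.pi ^ (((n : ℝ) - 1) / 4) * √((n : ℝ) * unitBallVolume n) *
      (2 : ℝ) ^ ((n : ℝ) / 4) * rho ^ (((n : ℝ) - 1) / 4)
  else
    Real.pi ^ (((n : ℝ) - 1) / 4) * √((n : ℝ) * unitBallVolume n) *
      (2 : ℝ) ^ (((n : ℝ) + 1) / 4) * rho ^ (((n : ℝ) - 2) / 4)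

/-- `c₁ = Δ'' / (√(16 π) √b₀)`, the only constant that depends on the dimension. -/
def const1 (n : ℕ) (b₀ : ℝ) : ℝ := Delta n * (1 / √(16 * Real.pi)) * (1 / √b₀)

/-- `c₂ = ρ₃⁴ 3³ 2⁷ b₀³`. -/
def const2 (β b₀ : ℝ) : ℝ := rho3 β ^ 4 * 3 ^ 3 * 2 ^ 7 * b₀ ^ 3

/-- `c₃ = b₀ / 4`. -/
def const3 (b₀ : ℝ) : ℝ := b₀ / 4

/-- `δ₀ = min {b₀, 1 / (ρ₃⁴ 3³ 2⁷ b₀³)}`. -/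
def delta0 (β b₀ : ℝ) : ℝ := min b₀ (1 / (rho3 β ^ 4 * 3 ^ 3 * 2 ^ 7 * b₀ ^ 3))

end GaussianInterpolation

end

/-!
Let `d = l - 1`. The Lagrange interpolation of degree `d` at the equally spaced points `y_k` of the
simplex gives weights `w_k` such that `L = δ_x - ∑ w_k δ_{y_k}` annihilates all polynomials of
degree `< l`, and `∑ |w_k| ≤ binom(2d - 1, d) ≤ 2^(2l - 3)`. Both facts follow from one recursion,
`sum_coord_mul_latticeWeight`, for multinomial sums of factorial powers. As `f = s` at the centers,
`f x - s x = L (f - s)`.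

By Bochner, `exp (-β |x - y|²)` is the integral of `exp (i √(2β) ⟨ξ, x - y⟩)` against the standard
Gaussian measure, so a finitely supported functional `L` embeds into `L²` of that measure through
its symbol `∑ L_y exp (i √(2β) ⟨ξ, y⟩)`. Three facts then give the error estimate.

* The inequality that defines the native space extends from test functions to functionals
  annihilating polynomials of degree `< m`, by mollification: `|L f| ≤ ‖f‖ ‖L‖`
  (`IsNativeBound.norm_apply_le`).
* The spline `s` acts on such functionals as an inner product with the functional built from its
  coefficients, and an orthogonal projection yields `|L (f - s)| ≤ ‖f‖ ‖L‖`
  (`IsSplineInterpolant.norm_apply_sub_le`).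
* In the symbol of the error functional only the Taylor remainders of order `l` survive, so
  its `L²` norm is controlled by the Gaussian moment of order `2l`
  (`norm_embed_errorFunctional_le`).

It remains to compare constants with `l = ⌊2 b₀ / δ⌋`, which is at least `m`, `b₀ / δ` and `n - 3`
or `n - 4`. The lower bound for `Δ''` contains `1 / j!` with `j = ⌊(n - 1) / 2⌋` from the volume of
the unit ball; the conditions on `n` say `2 j ≤ l + 2`, so that `j!` is at most `(l + 2) √(l!)`
(`dimension_bound`).
-/

noncomputable section

namespace GaussianInterpolation

/-! ### Polynomial interpolation on the lattice points of a simplex -/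

section

open Finset

/-- The factorial power `x (x + c) ⋯ (x + (k - 1) c) / k!`: the binomial coefficient
`binom(x, k)` for `c = -1`, and `binom(x + k - 1, k)` for `c = 1`. -/
def stepPow (c x : ℝ) (k : ℕ) : ℝ := (∏ j ∈ range k, (x + c * j)) / k.factorial

lemma succ_mul_stepPow (c x : ℝ) (k : ℕ) :
    ((k : ℝ) + 1) * stepPow c x (k + 1) = x * stepPow c (x + c) k := by
  unfold stepPow
  have h : ∏ j ∈ range (k + 1), (x + c * j) = x * ∏ j ∈ range k, (x + c + c * j) := by
    rw [prod_range_succ', mul_comm]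
    congr 1
    · simp
    · exact prod_congr rfl fun j _ => by push_cast; ring
  rw [h, Nat.factorial_succ]
  have := Nat.factorial_ne_zero k
  push_cast
  field_simp

lemma abs_stepPow_le {x : ℝ} (hx : 0 ≤ x) (k : ℕ) : |stepPow (-1) x k| ≤ stepPow 1 x k := by
  unfold stepPow
  rw [abs_div, abs_prod, Nat.abs_cast]
  gcongr with j hj
  rw [abs_le]
  have : (0 : ℝ) ≤ j := by positivity
  constructor <;> linarith

lemma stepPow_neg_one_self (d : ℕ) : stepPow (-1) d d = 1 := by
  unfold stepPow
  rw [div_eq_one_iff_eq (by positivity), ← prod_range_reflect, ← prod_range_add_one_eq_factorial]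
  push_cast
  refine prod_congr rfl fun j hj => ?_
  have := mem_range.1 hj
  rw [Nat.sub_sub, Nat.cast_sub (by omega)]
  push_cast
  ring

lemma stepPow_one_self_le (d : ℕ) : stepPow 1 ((d : ℝ) + 1) (d + 1) ≤ 2 ^ (2 * d + 1) := by
  have h : ∏ j ∈ range (d + 1), ((d : ℝ) + 1 + 1 * j) = ((d + 1).ascFactorial (d + 1) : ℕ) := by
    rw [Nat.ascFactorial_eq_prod_range]
    push_cast
    exact prod_congr rfl fun j _ => by ring
  unfold stepPow
  rw [h, Nat.ascFactorial_eq_factorial_mul_choose, Nat.cast_mul,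
    mul_div_cancel_left₀ _ (by positivity)]
  have := Nat.choose_le_two_pow (d + (d + 1)) (d + 1)
  rw [show d + (d + 1) = 2 * d + 1 by ring] at this ⊢
  exact_mod_cast this

variable {ι : Type*} [Fintype ι] [DecidableEq ι]

/-- The product of factorial powers over the coordinates. For `c = -1` and `∑ x = d` these are,
as functions of `x`, the Lagrange basis for the points `k ∈ ℕ^ι` with `∑ k = d`. -/
def latticeWeight (c : ℝ) (x : ι → ℝ) (k : ι → ℕ) : ℝ := ∏ i, stepPow c (x i) (k i)

lemma latticeWeight_shift (c : ℝ) (x : ι → ℝ) (k : ι → ℕ) (i : ι) :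
    ((k i : ℝ) + 1) * latticeWeight c x (k + Pi.single i 1) =
      x i * latticeWeight c (x + Pi.single i c) k := by
  unfold latticeWeight
  rw [← mul_prod_erase univ _ (mem_univ i), ← mul_prod_erase univ _ (mem_univ i), ← mul_assoc,
    ← mul_assoc]
  congr 1
  · simp [succ_mul_stepPow]
  · refine prod_congr rfl fun j hj => ?_
    simp [Pi.single_eq_of_ne (ne_of_mem_erase hj)]

/-- Multiplication by a coordinate lowers the degree of a lattice sum by one. -/
lemma sum_coord_mul_latticeWeight (c : ℝ) (x : ι → ℝ) (d : ℕ) (i : ι) (g : (ι → ℕ) → ℝ) :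
    ∑ k ∈ piAntidiag univ (d + 1), (k i : ℝ) * latticeWeight c x k * g k =
      x i * ∑ k ∈ piAntidiag univ d,
        latticeWeight c (x + Pi.single i c) k * g (k + Pi.single i 1) := by
  rw [mul_sum]
  symm
  refine sum_of_injOn (fun k => k + Pi.single i 1) (fun a _ b _ h => by simpa using h) ?_ ?_ ?_
  · intro k hk
    simp only [mem_coe, mem_piAntidiag] at hk ⊢
    simp_all [sum_add_distrib]
  · intro k hk hk'
    have hki : k i = 0 := by
      by_contra h0
      apply hk'
      have hk1 : k - Pi.single i 1 + Pi.single i 1 = k := by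
        ext j
        rcases eq_or_ne j i with rfl | hj
        · simp; omega
        · simp [hj]
      refine ⟨k - Pi.single i 1, ?_, hk1⟩
      have h2 : ∑ j, k j = d + 1 := by simpa using hk
      rw [← hk1] at h2
      simp only [Pi.add_apply, sum_add_distrib, sum_pi_single', mem_univ, if_true] at h2
      simpa using h2
    simp [hki]
  · intro k _
    have := latticeWeight_shift c x k i
    simp only [Pi.add_apply, Pi.single_eq_same, Nat.cast_add, Nat.cast_one]
    rw [← mul_assoc, ← this]

/-- The Chu-Vandermonde identity. -/
lemma sum_latticeWeight (c : ℝ) (d : ℕ) (x : ι → ℝ) :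
    ∑ k ∈ piAntidiag univ d, latticeWeight c x k = stepPow c (∑ i, x i) d := by
  induction d generalizing x with
  | zero => simp [latticeWeight, stepPow]
  | succ d ih =>
    have h1 : ((d : ℝ) + 1) * ∑ k ∈ piAntidiag univ (d + 1), latticeWeight c x k =
        ∑ i, ∑ k ∈ piAntidiag univ (d + 1), (k i : ℝ) * latticeWeight c x k * 1 := by
      rw [sum_comm, mul_sum]
      refine sum_congr rfl fun k hk => ?_
      have h2 : ∑ j, k j = d + 1 := by simpa using hk
      have h3 : ∑ j, (k j : ℝ) = d + 1 := by exact_mod_cast h2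
      simp_rw [mul_one]
      rw [← sum_mul, h3]
    have h4 : ((d : ℝ) + 1) ≠ 0 := by positivity
    apply mul_left_cancel₀ h4
    rw [h1, succ_mul_stepPow, sum_mul]
    refine sum_congr rfl fun i _ => ?_
    rw [sum_coord_mul_latticeWeight]
    simp [ih, sum_add_distrib]

lemma sum_abs_latticeWeight_le (d : ℕ) {x : ι → ℝ} (hx : ∀ i, 0 ≤ x i)
    (hsum : ∑ i, x i = d + 1) :
    ∑ k ∈ piAntidiag univ (d + 1), |latticeWeight (-1) x k| ≤ 2 ^ (2 * d + 1) := by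
  calc _ ≤ ∑ k ∈ piAntidiag univ (d + 1), latticeWeight 1 x k := by
        refine sum_le_sum fun k _ => ?_
        unfold latticeWeight
        rw [abs_prod]
        exact prod_le_prod (fun _ _ => abs_nonneg _) fun i _ => abs_stepPow_le (hx i) _
    _ = stepPow 1 ((d : ℝ) + 1) (d + 1) := by rw [sum_latticeWeight, hsum]
    _ ≤ _ := stepPow_one_self_le d

/-- Lattice interpolation in any degree `≥ m` reproduces `g` and its translates. Polynomials of
degree at most `m` have this property. -/
def LatticeExact (m : ℕ) (g : (ι → ℝ) → ℝ) : Prop :=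
  ∀ d : ℕ, m ≤ d → ∀ x v : ι → ℝ, ∑ i, x i = d →
    ∑ k ∈ piAntidiag univ d, latticeWeight (-1) x k * g (fun i => k i + v i) = g (x + v)

lemma latticeExact_one : LatticeExact (ι := ι) 0 fun _ => 1 := by
  intro d _ x v hx
  simp [sum_latticeWeight, hx, stepPow_neg_one_self]

lemma LatticeExact.affine_mul {m : ℕ} {g : (ι → ℝ) → ℝ} (hg : LatticeExact m g) (t : ι → ℝ)
    (b : ℝ) : LatticeExact (m + 1) fun x => (b + ∑ i, t i * x i) * g x := by
  intro d hd x v hx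
  obtain ⟨d, rfl⟩ : ∃ e, d = e + 1 := ⟨d - 1, by omega⟩
  have h1 : ∀ i, ∑ k ∈ piAntidiag univ (d + 1),
      (k i : ℝ) * latticeWeight (-1) x k * g (fun j => k j + v j) = x i * g (x + v) := by
    intro i
    rw [sum_coord_mul_latticeWeight (-1) x d i fun k => g (fun j => k j + v j)]
    congr 1
    have := hg d (by omega) (x + Pi.single i (-1)) (v + Pi.single i 1)
      (by simp [sum_add_distrib, hx])
    rw [show x + v = x + Pi.single i (-1) + (v + Pi.single i 1) by
      ext j; by_cases h : j = i
      · subst h; simp only [Pi.add_apply, Pi.single_eq_same]; ring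
      · simp [h], ← this]
    refine sum_congr rfl fun k _ => ?_
    congr 2
    ext j
    by_cases h : j = i
    · subst h; simp; ring
    · simp [h]
  have h2 := hg (d + 1) (by omega) x v hx
  calc _ = (b + ∑ i, t i * v i) * ∑ k ∈ piAntidiag univ (d + 1),
          latticeWeight (-1) x k * g (fun j => k j + v j) +
        ∑ i, t i * ∑ k ∈ piAntidiag univ (d + 1),
          (k i : ℝ) * latticeWeight (-1) x k * g (fun j => k j + v j) := by
        simp_rw [mul_sum]
        rw [sum_comm, ← sum_add_distrib]
        refine sum_congr rfl fun k _ => ?_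
        rw [show ∑ i, t i * (k i * latticeWeight (-1) x k * g (fun j => k j + v j)) =
          (∑ i, t i * k i) * (latticeWeight (-1) x k * g (fun j => k j + v j)) by
            rw [sum_mul]; exact sum_congr rfl fun i _ => by ring]
        simp_rw [mul_add, sum_add_distrib]
        ring
    _ = _ := by
        rw [h2]
        simp_rw [h1]
        rw [show ∑ i, t i * (x i * g (x + v)) = (∑ i, t i * x i) * g (x + v) by
          rw [sum_mul]; exact sum_congr rfl fun i _ => by ring]
        simp_rw [Pi.add_apply, mul_add, sum_add_distrib]
        ring

lemma LatticeExact.affine_pow_mul {m : ℕ} {g : (ι → ℝ) → ℝ} (hg : LatticeExact m g) (t : ι → ℝ)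
    (b : ℝ) (e : ℕ) : LatticeExact (m + e) fun x => (b + ∑ i, t i * x i) ^ e * g x := by
  induction e with
  | zero => simpa using hg
  | succ e ih =>
    simp_rw [pow_succ', mul_assoc]
    exact ih.affine_mul t b

lemma latticeExact_prod {κ : Type*} (s : Finset κ) (t : κ → ι → ℝ) (e : κ → ℕ) :
    LatticeExact (∑ a ∈ s, e a) fun x : ι → ℝ => ∏ a ∈ s, (∑ i, t a i * x i) ^ e a := by
  classical
  induction s using Finset.induction_on with
  | empty => simpa using latticeExact_one
  | insert a s ha ih =>
    simp_rw [sum_insert ha, prod_insert ha]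
    have := ih.affine_pow_mul (t a) 0 (e a)
    simpa [add_comm] using this

lemma latticeExact_pow (t : ι → ℝ) (e : ℕ) :
    LatticeExact e fun x : ι → ℝ => (∑ i, t i * x i) ^ e := by
  simpa using latticeExact_one.affine_pow_mul t 0 e

lemma LatticeExact.sum_eq {m : ℕ} {g : (ι → ℝ) → ℝ} (hg : LatticeExact m g) {d : ℕ} (hd : m ≤ d)
    {x : ι → ℝ} (hx : ∑ i, x i = d) :
    ∑ k ∈ piAntidiag univ d, latticeWeight (-1) x k * g (fun i => k i) = g x := by
  simpa using hg d hd x 0 hx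

end

/-! ### Taylor remainder of the complex exponential -/

section

/-- The remainder of order `l` of the Taylor series of `exp (i θ)`. -/
def expRemainder (l : ℕ) (θ : ℝ) : ℂ :=
  Complex.exp (θ * Complex.I) - ∑ j ∈ Finset.range l, (θ * Complex.I) ^ j / (j.factorial : ℂ)

lemma hasDerivAt_expRemainder (l : ℕ) (θ : ℝ) :
    HasDerivAt (expRemainder (l + 1)) (Complex.I * expRemainder l θ) θ := by
  have h0 : HasDerivAt (fun θ : ℝ => (θ : ℂ) * Complex.I) Complex.I θ := by
    simpa using (Complex.ofRealCLM.hasDerivAt (x := θ)).mul_const Complex.I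
  unfold expRemainder
  simp_rw [Finset.sum_range_succ']
  rw [mul_sub, Finset.mul_sum, mul_comm]
  refine h0.cexp.sub ?_
  simp only [pow_zero, Nat.factorial_zero, Nat.cast_one]
  refine HasDerivAt.add_const _ (HasDerivAt.fun_sum fun j _ => ?_)
  have := (h0.pow (j + 1)).div_const ((j + 1).factorial : ℂ)
  refine this.congr_deriv ?_
  rw [Nat.factorial_succ]
  have h1 : ((j : ℂ) + 1) ≠ 0 := by exact_mod_cast Nat.succ_ne_zero j
  have h2 : (j.factorial : ℂ) ≠ 0 := by exact_mod_cast Nat.factorial_ne_zero j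
  push_cast

  field_simp

lemma norm_expRemainder_le_of_nonneg (l : ℕ) {θ : ℝ} (hθ : 0 ≤ θ) :
    ‖expRemainder l θ‖ ≤ θ ^ l / l.factorial := by
  induction l generalizing θ with
  | zero => simp [expRemainder, Complex.norm_exp_ofReal_mul_I]
  | succ l ih =>
    have hB : ∀ x : ℝ, HasDerivAt (fun x : ℝ => x ^ (l + 1) / ((l + 1).factorial : ℝ))
        (x ^ l / l.factorial) x := by
      intro x
      refine ((hasDerivAt_pow (l + 1) x).div_const _).congr_deriv ?_
      rw [Nat.factorial_succ]
      push_cast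

      field_simp
    refine image_norm_le_of_norm_deriv_right_le_deriv_boundary (a := 0) (b := θ)
      (f := expRemainder (l + 1)) (f' := fun x => Complex.I * expRemainder l x)
      (fun x _ => (hasDerivAt_expRemainder l x).continuousAt.continuousWithinAt)
      (fun x _ => (hasDerivAt_expRemainder l x).hasDerivWithinAt) ?_ hB ?_ ⟨hθ, le_rfl⟩
    · simp [expRemainder, Finset.sum_range_succ']
    · intro x hx
      simpa using ih hx.1

lemma norm_expRemainder_le (l : ℕ) (θ : ℝ) :
    ‖expRemainder l θ‖ ≤ |θ| ^ l / l.factorial := by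
  rcases le_total 0 θ with h | h
  · simpa [abs_of_nonneg h] using norm_expRemainder_le_of_nonneg l h
  · have := norm_expRemainder_le_of_nonneg l (neg_nonneg.2 h)
    rw [abs_of_nonpos h]
    refine le_of_eq_of_le ?_ this
    rw [← Complex.norm_conj]
    congr 1
    simp [expRemainder, ← Complex.exp_conj]

end

/-! ### Moments of the standard Gaussian vector -/

section

open ProbabilityTheory

lemma exp_sq_gaussianReal :
    Integrable (fun x : ℝ => Real.exp (x ^ 2 / 4)) (gaussianReal 0 1) ∧
      ∫ x : ℝ, Real.exp (x ^ 2 / 4) ∂(gaussianReal 0 1) = √2 := by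
  have hpdf : ∀ x : ℝ, gaussianPDFReal 0 1 x * Real.exp (x ^ 2 / 4) =
      (√(2 * Real.pi))⁻¹ * Real.exp (-(1 / 4) * x ^ 2) := by
    intro x
    simp only [gaussianPDFReal, NNReal.coe_one, mul_one, sub_zero]
    rw [mul_assoc, ← Real.exp_add]
    ring_nf
  constructor
  · rw [gaussianReal_of_var_ne_zero _ one_ne_zero,
      integrable_withDensity_iff_integrable_smul' (measurable_gaussianPDF 0 1)
        (by simp [gaussianPDF])]
    simp only [gaussianPDF, ENNReal.toReal_ofReal (gaussianPDFReal_nonneg 0 1 _), smul_eq_mul, hpdf]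
    exact (integrable_exp_neg_mul_sq (by norm_num)).const_mul _
  · rw [integral_gaussianReal_eq_integral_smul one_ne_zero]
    simp only [smul_eq_mul, hpdf]
    rw [integral_const_mul, integral_gaussian, ← Real.sqrt_inv, ← Real.sqrt_mul (by positivity)]
    congr 1
    field_simp
    norm_num

lemma exp_sq_stdGaussian (n : ℕ) :
    Integrable (fun ξ : Space n => Real.exp (‖ξ‖ ^ 2 / 4)) (stdGaussian (Space n)) ∧
      ∫ ξ : Space n, Real.exp (‖ξ‖ ^ 2 / 4) ∂(stdGaussian (Space n)) = √2 ^ n := by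
  have h : ∀ x : Fin n → ℝ, Real.exp (‖WithLp.toLp 2 x‖ ^ 2 / 4) =
      ∏ i, Real.exp (x i ^ 2 / 4) := by
    intro x
    rw [EuclideanSpace.real_norm_sq_eq, Finset.sum_div, Real.exp_sum]
  have hm : AEMeasurable (WithLp.toLp 2 : (Fin n → ℝ) → Space n)
      (Measure.pi fun _ => gaussianReal 0 1) := by fun_prop
  have hc : AEStronglyMeasurable (fun ξ : Space n => Real.exp (‖ξ‖ ^ 2 / 4))
      ((Measure.pi fun _ => gaussianReal 0 1).map (WithLp.toLp 2 : (Fin n → ℝ) → Space n)) :=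
    Continuous.aestronglyMeasurable (by fun_prop)
  rw [← map_pi_eq_stdGaussian]
  constructor
  · rw [integrable_map_measure hc hm]
    simp only [Function.comp_def, h]
    exact Integrable.fintype_prod (f := fun _ x => Real.exp (x ^ 2 / 4))
      fun _ => exp_sq_gaussianReal.1
  · rw [integral_map hm hc]
    simp only [h]
    rw [integral_fintype_prod_eq_prod (f := fun _ x => Real.exp (x ^ 2 / 4))]
    simp [exp_sq_gaussianReal.2]

/-- Even moments of the standard Gaussian vector, bounded through `𝔼 exp (‖ξ‖² / 4) = 2 ^ (n / 2)`.
The factor `4 ^ l` stays close to optimal when `n` is comparable with `l`. -/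
lemma integral_norm_pow_stdGaussian_le (n l : ℕ) :
    Integrable (fun ξ : Space n => (‖ξ‖ ^ l) ^ 2) (stdGaussian (Space n)) ∧
      ∫ ξ : Space n, (‖ξ‖ ^ l) ^ 2 ∂(stdGaussian (Space n)) ≤ l.factorial * 4 ^ l * √2 ^ n := by
  have hle : ∀ ξ : Space n, (‖ξ‖ ^ l) ^ 2 ≤ l.factorial * 4 ^ l * Real.exp (‖ξ‖ ^ 2 / 4) := by
    intro ξ
    have := Real.pow_div_factorial_le_exp (‖ξ‖ ^ 2 / 4) (by positivity) l
    rw [div_le_iff₀ (by positivity), div_pow, div_le_iff₀ (by positivity)] at this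
    calc (‖ξ‖ ^ l) ^ 2 = (‖ξ‖ ^ 2) ^ l := by rw [← pow_mul, ← pow_mul, mul_comm]
      _ ≤ _ := this
      _ = _ := by ring
  have hi := (exp_sq_stdGaussian n).1.const_mul (l.factorial * 4 ^ l)
  have hi' : Integrable (fun ξ : Space n => (‖ξ‖ ^ l) ^ 2) (stdGaussian (Space n)) := by
    refine hi.mono' (Continuous.aestronglyMeasurable (by fun_prop)) (.of_forall fun ξ => ?_)
    rw [Real.norm_of_nonneg (by positivity)]
    exact hle ξ
  refine ⟨hi', (integral_mono hi' hi hle).trans_eq ?_⟩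
  rw [integral_const_mul, (exp_sq_stdGaussian n).2]

end

/-! ### Functionals on the native space and the spline error -/

section

open ProbabilityTheory BoundedContinuousFunction Finsupp

variable {n : ℕ}

/-- The character `ξ ↦ exp (i √(2β) ⟨ξ, y⟩)`. -/
def feature (β : ℝ) (y : Space n) : Space n →ᵇ ℂ := innerProbChar (√(2 * β) • y)

lemma feature_apply (β : ℝ) (y ξ : Space n) :
    feature β y ξ = Complex.exp ((√(2 * β) * inner ℝ ξ y : ℝ) * Complex.I) := by
  rw [feature, innerProbChar_apply, real_inner_smul_right]

lemma norm_feature (β : ℝ) (y ξ : Space n) : ‖feature β y ξ‖ = 1 := by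
  rw [feature_apply, Complex.norm_exp_ofReal_mul_I]

lemma feature_add (β : ℝ) (x y ξ : Space n) :
    feature β (x + y) ξ = feature β x ξ * feature β y ξ := by
  simp only [feature_apply, inner_add_right, ← Complex.exp_add]
  push_cast
  ring_nf

lemma feature_neg (β : ℝ) (y ξ : Space n) : feature β (-y) ξ = conj (feature β y ξ) := by
  simp [feature_apply, ← Complex.exp_conj, inner_neg_right]

/-- Bochner's representation of the Gaussian kernel. -/
lemma integral_feature_mul_conj {β : ℝ} (hβ : 0 < β) (x y : Space n) :
    ∫ ξ, feature β x ξ * conj (feature β y ξ) ∂(stdGaussian (Space n)) =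
      (gaussian n β (x - y) : ℂ) := by
  simp_rw [← feature_neg, ← feature_add]
  unfold feature
  rw [← charFun_eq_integral_innerProbChar, charFun_stdGaussian, norm_smul, gaussian,
    ← sub_eq_add_neg]
  rw [Real.norm_of_nonneg (by positivity)]
  push_cast
  congr 1
  rw [mul_pow, ← Complex.ofReal_pow (√(2 * β)), Real.sq_sqrt (by positivity)]
  push_cast
  ring

/-- The symbol of a finitely supported functional: `ξ ↦ ∑ L y exp (i √(2β) ⟨ξ, y⟩)`. -/
def symbol (β : ℝ) (L : Space n →₀ ℂ) : Space n →ᵇ ℂ := linearCombination ℂ (feature β) L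

lemma symbol_apply (β : ℝ) (L : Space n →₀ ℂ) (ξ : Space n) :
    symbol β L ξ = ∑ y ∈ L.support, L y * feature β y ξ := by
  simp [symbol, linearCombination_apply, Finsupp.sum]

/-- The embedding of finitely supported functionals into `L²` of the spectral measure of the
Gaussian kernel. The norm of the image is the norm of the functional dual to the native space. -/
def embed (β : ℝ) : (Space n →₀ ℂ) →ₗ[ℂ] Lp ℂ 2 (stdGaussian (Space n)) :=
  (BoundedContinuousFunction.toLp 2 (stdGaussian (Space n)) ℂ).toLinearMap ∘ₗ
    linearCombination ℂ (feature β)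

lemma embed_apply (β : ℝ) (L : Space n →₀ ℂ) :
    embed β L = BoundedContinuousFunction.toLp 2 (stdGaussian (Space n)) ℂ (symbol β L) := rfl

lemma inner_embed (β : ℝ) (L M : Space n →₀ ℂ) :
    inner ℂ (embed β M) (embed β L) =
      ∫ ξ, symbol β L ξ * conj (symbol β M ξ) ∂(stdGaussian (Space n)) := by
  rw [embed_apply, embed_apply, BoundedContinuousFunction.inner_toLp]

lemma norm_embed_sq (β : ℝ) (L : Space n →₀ ℂ) :
    ‖embed β L‖ ^ 2 = ∫ ξ, ‖symbol β L ξ‖ ^ 2 ∂(stdGaussian (Space n)) := by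
  have h := inner_embed β L L
  rw [inner_self_eq_norm_sq_to_K] at h
  simp_rw [Complex.mul_conj'] at h
  have h2 : ((‖embed β L‖ ^ 2 : ℝ) : ℂ) =
      ((∫ ξ, ‖symbol β L ξ‖ ^ 2 ∂(stdGaussian (Space n)) : ℝ) : ℂ) := by
    rw [← integral_complex_ofReal]
    push_cast
    exact h
  exact_mod_cast h2

/-- `L` annihilates the polynomials of degree `< m`. -/
def Annihilates (m : ℕ) (L : Space n →₀ ℂ) : Prop :=
  ∀ q : MvPolynomial (Fin n) ℂ, PolyDegreeLT m q → linearCombination ℂ (polyEval q) L = 0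

lemma Annihilates.sub {m : ℕ} {L M : Space n →₀ ℂ} (hL : Annihilates m L) (hM : Annihilates m M) :
    Annihilates m (L - M) := fun q hq => by rw [map_sub, hL q hq, hM q hq, sub_zero]

lemma Annihilates.smul {m : ℕ} {L : Space n →₀ ℂ} (hL : Annihilates m L) (a : ℂ) :
    Annihilates m (a • L) := fun q hq => by rw [map_smul, hL q hq, smul_zero]

lemma polyDegreeLT_of_totalDegree {m : ℕ} {q : MvPolynomial (Fin n) ℂ} (h : q.totalDegree < m) :
    PolyDegreeLT m q := by
  intro a ha
  refine lt_of_le_of_lt ?_ h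
  have := MvPolynomial.le_totalDegree ha
  rwa [Finsupp.sum_fintype _ _ (fun _ => rfl)] at this

lemma Annihilates.shifted_monomial {m : ℕ} {L : Space n →₀ ℂ} (hL : Annihilates m L)
    (α : Fin n → ℕ) (hα : ∑ i, α i < m) (x : Space n) :
    linearCombination ℂ (fun y : Space n => ∏ i, ((x + y) i : ℂ) ^ α i) L = 0 := by
  have := hL (∏ i, (MvPolynomial.C (x i : ℂ) + MvPolynomial.X i) ^ α i) ?_
  · convert this using 3
    ext y
    simp [polyEval, map_prod]
  · refine polyDegreeLT_of_totalDegree (lt_of_le_of_lt ?_ hα)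
    refine (MvPolynomial.totalDegree_finsetProd _ _).trans (Finset.sum_le_sum fun i _ => ?_)
    refine (MvPolynomial.totalDegree_pow _ _).trans ?_
    refine (Nat.mul_le_mul_left _ ((MvPolynomial.totalDegree_add _ _).trans ?_)).trans_eq (mul_one _)
    simp

/-- The convolution of the functional `L`, regarded as a discrete measure, with `φ`. -/
def mollify (φ : Space n → ℝ) (L : Space n →₀ ℂ) (x : Space n) : ℂ :=
  ∑ y ∈ L.support, L y * (φ (x - y) : ℂ)

lemma integral_mul_mollify {φ : Space n → ℝ} (hφ : Continuous φ) (hφ' : HasCompactSupport φ)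
    (L : Space n →₀ ℂ) {g : Space n → ℂ} (hg : Continuous g) :
    ∫ x, g x * mollify φ L x = ∫ x, (φ x : ℂ) * linearCombination ℂ (fun y => g (x + y)) L := by
  have hcs : HasCompactSupport fun x => (φ x : ℂ) := hφ'.comp_left Complex.ofReal_zero
  have hi : ∀ y, Integrable fun x => (φ x : ℂ) * (L y * g (x + y)) := fun y =>
    Continuous.integrable_of_hasCompactSupport (by fun_prop) hcs.mul_right
  have hi2 : ∀ y, Integrable fun x => g x * (L y * (φ (x - y) : ℂ)) := fun y => by
    have := (hi y).comp_sub_right y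
    refine this.congr (.of_forall fun x => ?_)
    simp only [sub_add_cancel]
    ring
  simp only [mollify, linearCombination_apply, Finsupp.sum, Finset.mul_sum, smul_eq_mul]
  rw [integral_finsetSum _ fun y _ => hi y, integral_finsetSum _ fun y _ => hi2 y]
  refine Finset.sum_congr rfl fun y _ => ?_
  rw [← integral_sub_right_eq_self (fun x => (φ x : ℂ) * (L y * g (x + y))) y]
  refine integral_congr_ae (.of_forall fun x => ?_)
  simp only [sub_add_cancel]
  ring

lemma contDiff_mollify {φ : Space n → ℝ} (hφ : ContDiff ℝ ∞ φ) (L : Space n →₀ ℂ) :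
    ContDiff ℝ ∞ (mollify φ L) := by
  unfold mollify
  refine ContDiff.sum fun y _ => contDiff_const.mul ?_
  exact Complex.ofRealCLM.contDiff.comp (hφ.comp (contDiff_id.sub contDiff_const))

lemma hasCompactSupport_mollify {φ : Space n → ℝ} (hφ' : HasCompactSupport φ) (L : Space n →₀ ℂ) :
    HasCompactSupport (mollify φ L) := by
  classical
  have h : ∀ s : Finset (Space n),
      HasCompactSupport fun x => ∑ y ∈ s, L y * (φ (x - y) : ℂ) := by
    intro s
    induction s using Finset.induction_on with
    | empty => exact HasCompactSupport.zero
    | insert a s ha ih =>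
      simp_rw [Finset.sum_insert ha]
      refine HasCompactSupport.add (HasCompactSupport.mul_left ?_) ih
      have := hφ'.comp_homeomorph (Homeomorph.subRight a)
      exact this.comp_left (g := Complex.ofReal) Complex.ofReal_zero
  exact h _

lemma isTestFunction_mollify {φ : Space n → ℝ} (hφ : ContDiff ℝ ∞ φ) (hφ' : HasCompactSupport φ)
    {m : ℕ} {L : Space n →₀ ℂ} (hL : Annihilates m L) : IsTestFunction m (mollify φ L) := by
  refine ⟨contDiff_mollify hφ L, hasCompactSupport_mollify hφ' L, fun α hα => ?_⟩
  rw [integral_mul_mollify hφ.continuous hφ' L (by fun_prop)]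
  simp_rw [hL.shifted_monomial α hα, mul_zero, integral_zero]

/-- The energy is the squared `L²` norm of the Fourier transform of `ψ` with respect to the
spectral measure of the kernel. -/
lemma energy_eq {β : ℝ} (hβ : 0 < β) {ψ : Space n → ℂ} (hψ : Continuous ψ)
    (hψ' : HasCompactSupport ψ) :
    energy (gaussian n β) ψ =
      ∫ ξ, ‖∫ x, feature β x ξ * ψ x‖ ^ 2 ∂(stdGaussian (Space n)) := by
  have hint : Integrable ψ := hψ.integrable_of_hasCompactSupport hψ'
  have hfc : Continuous fun p : Space n × Space n => feature β p.2 p.1 := by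
    simp_rw [feature_apply]
    fun_prop
  have hprod : Integrable (fun z : Space n × Space n => ψ z.1 * conj (ψ z.2))
      (volume.prod volume) := by
    exact hint.mul_prod (Complex.conjCLE.toContinuousLinearMap.integrable_comp hint)
  let F : Space n → Space n × Space n → ℂ := fun ξ z =>
    (feature β z.1 ξ * conj (feature β z.2 ξ)) * (ψ z.1 * conj (ψ z.2))
  have hF : Integrable (Function.uncurry F)
      ((stdGaussian (Space n)).prod (volume.prod volume)) := by
    refine (hprod.comp_snd (stdGaussian (Space n))).mono ?_ (.of_forall fun p => ?_)
    · have hfc1 := hfc.comp ((continuous_fst (X := Space n) (Y := Space n × Space n)).prodMk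
        (continuous_fst.comp continuous_snd))
      have hfc2 := hfc.comp ((continuous_fst (X := Space n) (Y := Space n × Space n)).prodMk
        (continuous_snd.comp continuous_snd))
      simp only [Function.comp_def] at hfc1 hfc2
      refine Continuous.aestronglyMeasurable ?_
      simp only [F, Function.uncurry_def]
      fun_prop
    · simp [F, Function.uncurry, norm_feature]
  have h1 : ((∫ ξ, ‖∫ x, feature β x ξ * ψ x‖ ^ 2 ∂(stdGaussian (Space n)) : ℝ) : ℂ) =
      ∫ ξ, ∫ z, F ξ z ∂(volume.prod volume) ∂(stdGaussian (Space n)) := by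
    rw [← integral_complex_ofReal]
    congr 1
    ext ξ
    rw [Complex.ofReal_pow, ← Complex.mul_conj', ← integral_conj, ← integral_prod_mul]
    congr 1
    ext z
    simp only [F, map_mul]
    ring
  have h2 : ∫ ξ, ∫ z, F ξ z ∂(volume.prod volume) ∂(stdGaussian (Space n)) =
      ∫ x, ∫ y, (gaussian n β (x - y) : ℂ) * ψ x * conj (ψ y) := by
    rw [integral_integral_swap hF,
      integral_prod (fun z => ∫ ξ, F ξ z ∂stdGaussian (Space n)) hF.integral_prod_right]
    congr 1
    ext x
    congr 1
    ext y
    simp only [F]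
    rw [integral_mul_const, integral_feature_mul_conj hβ, mul_assoc]
  rw [energy, ← h2, ← h1, Complex.ofReal_re]

/-- The Fourier transform of `mollify φ L` is the symbol of `L` times that of `φ`, and the latter
is at most `∫ φ = 1` in absolute value. -/
lemma energy_mollify_le {β : ℝ} (hβ : 0 < β) {φ : Space n → ℝ} (hφ : ContDiff ℝ ∞ φ)
    (hφ' : HasCompactSupport φ) (hnn : ∀ x, 0 ≤ φ x) (hone : ∫ x, φ x = 1) (L : Space n →₀ ℂ) :
    √(energy (gaussian n β) (mollify φ L)) ≤ ‖embed β L‖ := by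
  rw [energy_eq hβ (contDiff_mollify hφ L).continuous (hasCompactSupport_mollify hφ' L)]
  refine Real.sqrt_le_iff.2 ⟨norm_nonneg _, ?_⟩
  rw [norm_embed_sq]
  refine integral_mono_of_nonneg (.of_forall fun ξ => by positivity) ?_ (.of_forall fun ξ => ?_)
  · refine Integrable.mono' (integrable_const (‖symbol β L‖ ^ 2))
      (Continuous.aestronglyMeasurable (by fun_prop)) (.of_forall fun ξ => ?_)
    rw [Real.norm_of_nonneg (by positivity)]
    gcongr
    exact (symbol β L).norm_coe_le_norm ξ
  · have hc : Continuous fun x => feature β x ξ := by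
      simp_rw [feature_apply]
      fun_prop
    simp only
    gcongr
    rw [integral_mul_mollify hφ.continuous hφ' L hc]
    have h1 : ∀ x, linearCombination ℂ (fun y => feature β (x + y) ξ) L =
        feature β x ξ * symbol β L ξ := by
      intro x
      rw [symbol_apply, linearCombination_apply, Finsupp.sum, Finset.mul_sum]
      refine Finset.sum_congr rfl fun y _ => ?_
      rw [feature_add, smul_eq_mul]
      ring
    simp_rw [h1]
    refine (norm_integral_le_integral_norm _).trans_eq ?_
    simp_rw [norm_mul, norm_feature, one_mul, Complex.norm_real, Real.norm_of_nonneg (hnn _)]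
    rw [integral_mul_const, hone, one_mul]

/-- The native-space inequality extends from test functions to finitely supported functionals. -/
lemma IsNativeBound.norm_apply_le {β : ℝ} (hβ : 0 < β) {m : ℕ} {f : Space n → ℂ}
    (hf : Continuous f) {C : ℝ} (hC : IsNativeBound (gaussian n β) m f C) {L : Space n →₀ ℂ}
    (hL : Annihilates m L) : ‖linearCombination ℂ f L‖ ≤ C * ‖embed β L‖ := by
  set G : Space n → ℂ := fun x => linearCombination ℂ (fun y => f (x + y)) L with hG
  have hGc : Continuous G := by
    simp only [hG, linearCombination_apply, Finsupp.sum]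
    fun_prop
  have hG0 : G 0 = linearCombination ℂ f L := by simp [hG]
  refine le_of_forall_pos_le_add fun ε hε => ?_
  obtain ⟨r, hr, hrG⟩ := Metric.continuousAt_iff.1
    ((hGc.comp continuous_neg).continuousAt (x := 0)) ε hε
  let φ : ContDiffBump (0 : Space n) := ⟨r / 2, r, by positivity, by linarith⟩
  have hφ : ContDiff ℝ ∞ (φ.normed volume) := φ.contDiff_normed
  have hφ' : HasCompactSupport (φ.normed volume) := φ.hasCompactSupport_normed
  -- A convolution at `0` integrates `φ x` against the value at `-x`, hence the reflection of `G`.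
  have h1 := φ.dist_normed_convolution_le (μ := volume) (x₀ := 0) (g := G ∘ Neg.neg) (ε := ε)
    (hGc.comp continuous_neg).aestronglyMeasurable fun x hx => (hrG hx).le
  have h2 := hC.2 _ (isTestFunction_mollify hφ hφ' hL)
  rw [integral_mul_mollify hφ.continuous hφ' L hf] at h2
  have h3 : convolution (φ.normed volume) (G ∘ Neg.neg) (ContinuousLinearMap.lsmul ℝ ℝ) volume 0 =
      ∫ x, (φ.normed volume x : ℂ) * linearCombination ℂ (fun y => f (x + y)) L := by
    simp [convolution, hG]
  rw [h3] at h1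
  simp only [Function.comp_apply, neg_zero, hG0] at h1
  have h4 := energy_mollify_le hβ hφ hφ' (fun x => φ.nonneg_normed x) (φ.integral_normed) L
  have h5 := mul_le_mul_of_nonneg_left h4 hC.1
  rw [dist_comm, dist_eq_norm] at h1
  have h6 := norm_sub_norm_le (linearCombination ℂ f L)
    (∫ x, (φ.normed volume x : ℂ) * linearCombination ℂ (fun y => f (x + y)) L)
  linarith

/-- The error inequality for spline interpolation. Subtract from `L` its component along the
functional `B` that generates the spline. This does not change `L (f - s)`, as `f - s` vanishes at
the centers; it does not increase the norm of `L`; and the result annihilates `s`. -/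
lemma IsSplineInterpolant.norm_apply_sub_le {β : ℝ} (hβ : 0 < β) {m : ℕ} {f s : Space n → ℂ}
    (hf : Continuous f) {C : ℝ} (hC : IsNativeBound (gaussian n β) m f C) {X : Finset (Space n)}
    (hs : IsSplineInterpolant (gaussian n β) m X f s) {L : Space n →₀ ℂ}
    (hL : Annihilates m L) : ‖linearCombination ℂ (f - s) L‖ ≤ C * ‖embed β L‖ := by
  obtain ⟨p, c, hp, hc, hsx, hfs⟩ := hs
  set B : Space n →₀ ℂ := ∑ y ∈ X, single y (conj (c y)) with hB
  have hBlin : ∀ g : Space n → ℂ, linearCombination ℂ g B = ∑ y ∈ X, conj (c y) * g y := by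
    intro g
    simp [hB, map_sum]
  have hBann : Annihilates m B := by
    intro q hq
    rw [hBlin]
    have h1 := hc (MvPolynomial.map (starRingEnd ℂ) q)
      fun a ha => hq a (MvPolynomial.support_map_subset _ _ ha)
    have h2 : ∀ y, polyEval (MvPolynomial.map (starRingEnd ℂ) q) y = conj (polyEval q y) := by
      intro y
      unfold polyEval
      rw [MvPolynomial.eval_map]
      simp [MvPolynomial.eval₂_eq', MvPolynomial.eval_eq', map_sum, map_prod]
    simp_rw [h2] at h1
    have := congrArg (starRingEnd ℂ) h1
    simpa [map_sum] using this
  have hinner : ∀ M : Space n →₀ ℂ, inner ℂ (embed β B) (embed β M) =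
      linearCombination ℂ (fun x => ∑ y ∈ X, c y * (gaussian n β (x - y) : ℂ)) M := by
    intro M
    have h1 : ∀ y x : Space n, inner ℂ (embed β (single y 1)) (embed β (single x 1)) =
        (gaussian n β (x - y) : ℂ) := by
      intro y x
      rw [inner_embed, ← integral_feature_mul_conj hβ]
      simp [symbol]
    have h2 : ∀ (y : Space n) (a : ℂ), embed β (single y a) = a • embed β (single y 1) := by
      intro y a
      rw [← map_smul, smul_single, smul_eq_mul, mul_one]
    have h3 : embed β M = ∑ x ∈ M.support, M x • embed β (single x 1) := by
      conv_lhs => rw [← M.sum_single, Finsupp.sum, map_sum]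
      exact Finset.sum_congr rfl fun x _ => h2 _ _
    rw [h3, hB, map_sum, linearCombination_apply, Finsupp.sum, inner_sum]
    refine Finset.sum_congr rfl fun x _ => ?_
    rw [sum_inner, smul_eq_mul, Finset.mul_sum]
    refine Finset.sum_congr rfl fun y _ => ?_
    rw [h2 y, inner_smul_left, inner_smul_right, h1, Complex.conj_conj]
    ring
  have hsM : ∀ M : Space n →₀ ℂ, Annihilates m M →
      linearCombination ℂ s M = inner ℂ (embed β B) (embed β M) := by
    intro M hM
    rw [hinner, show s = polyEval p + fun x => ∑ y ∈ X, c y * (gaussian n β (x - y) : ℂ) from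
      funext hsx]
    have h0 := hM p hp
    simp only [linearCombination_apply, Pi.add_apply, smul_add, Finsupp.sum,
      Finset.sum_add_distrib] at h0 ⊢
    rw [h0, zero_add]
  -- `t` may be arbitrary if `embed β B = 0`; the projection covers that case too.
  obtain ⟨t, ht⟩ := Submodule.mem_span_singleton.1
    ((Submodule.span ℂ {embed β B}).starProjection_apply_mem (embed β L))
  set M := L - t • B with hM
  have hMann : Annihilates m M := hL.sub (hBann.smul t)
  have hEM : embed β M = embed β L - (Submodule.span ℂ {embed β B}).starProjection (embed β L) := by
    rw [hM, map_sub, map_smul, ht]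
  have horth : inner ℂ (embed β B) (embed β M) = 0 := by
    rw [hEM]
    exact Submodule.sub_starProjection_mem_orthogonal (K := Submodule.span ℂ {embed β B}) _ _
      (Submodule.mem_span_singleton_self _)
  have hnorm : ‖embed β M‖ ≤ ‖embed β L‖ := by
    have h1 : embed β L = embed β M + t • embed β B := by rw [hM, map_sub, map_smul]; abel
    have h2 : inner ℂ (embed β M) (t • embed β B) = 0 := by
      rw [inner_smul_right, ← inner_conj_symm, horth, map_zero, mul_zero]
    have h3 := norm_add_sq_eq_norm_sq_add_norm_sq_of_inner_eq_zero _ _ h2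
    rw [← h1] at h3
    nlinarith [norm_nonneg (embed β M), norm_nonneg (embed β L), norm_nonneg (t • embed β B)]
  have hsub : ∀ N : Space n →₀ ℂ, linearCombination ℂ (f - s) N =
      linearCombination ℂ f N - linearCombination ℂ s N := by
    intro N
    simp only [linearCombination_apply, Pi.sub_apply, smul_sub, Finsupp.sum,
      Finset.sum_sub_distrib]
  have hBzero : linearCombination ℂ (f - s) B = 0 := by
    rw [hBlin]
    exact Finset.sum_eq_zero fun y hy => by simp [hfs y hy]
  have hLM : linearCombination ℂ (f - s) L = linearCombination ℂ f M := by
    have h1 : linearCombination ℂ (f - s) M = linearCombination ℂ (f - s) L := by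
      rw [hM, map_sub, map_smul, hBzero, smul_zero, sub_zero]
    rw [← h1, hsub, hsM M hMann, horth, sub_zero]
  rw [hLM]
  exact (hC.norm_apply_le hβ hf hMann).trans (mul_le_mul_of_nonneg_left hnorm hC.1)

end

/-! ### The error functional of equally spaced points -/

section

open ProbabilityTheory Finsupp

variable {n : ℕ}

/-- The point of `R^n` with lattice coordinates `u`, that is, with barycentric coordinates
`u / d`. -/
def latticePoint (S : Affine.Simplex ℝ (Space n) n) (d : ℕ) (u : Fin (n + 1) → ℝ) : Space n :=
  ∑ i, (u i / (d : ℝ)) • S.points i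

lemma exists_latticePoint {S : Affine.Simplex ℝ (Space n) n} {x : Space n} (hx : x ∈ solid S)
    {d : ℕ} (hd : d ≠ 0) :
    ∃ u : Fin (n + 1) → ℝ, (∀ i, 0 ≤ u i) ∧ ∑ i, u i = d ∧ x = latticePoint S d u := by
  rw [solid, convexHull_range_eq_exists_affineCombination] at hx
  obtain ⟨s, w, hw0, hw1, rfl⟩ := hx
  have hd' : (d : ℝ) ≠ 0 := by exact_mod_cast hd
  refine ⟨fun i => d * (if i ∈ s then w i else 0), fun i => ?_, ?_, ?_⟩
  · by_cases hi : i ∈ s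
    · simpa [hi] using mul_nonneg (by positivity) (hw0 i hi)
    · simp [hi]
  · rw [← Finset.mul_sum]
    simp [hw1]
  · rw [Finset.affineCombination_eq_linear_combination _ _ _ hw1, latticePoint]
    simp_rw [mul_div_cancel_left₀ _ hd']
    simp [ite_smul]

lemma latticePoint_mem_solid (S : Affine.Simplex ℝ (Space n) n) {d : ℕ} (hd : d ≠ 0)
    {k : Fin (n + 1) → ℕ} (hk : ∑ i, k i = d) : latticePoint S d (fun i => k i) ∈ solid S := by
  have hd' : (d : ℝ) ≠ 0 := by exact_mod_cast hd
  refine (convex_convexHull ℝ _).sum_mem (fun i _ => by positivity) ?_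
    fun i _ => subset_convexHull ℝ _ (Set.mem_range_self i)
  rw [← Finset.sum_div, div_eq_one_iff_eq hd']
  exact_mod_cast hk

lemma latticePoint_mem_equallySpaced (S : Affine.Simplex ℝ (Space n) n) {d : ℕ}
    {k : Fin (n + 1) → ℕ} (hk : ∑ i, k i = d) :
    latticePoint S d (fun i => k i) ∈ equallySpaced S d := ⟨k, hk, rfl⟩

lemma norm_sub_le_diam {S : Affine.Simplex ℝ (Space n) n} {x y : Space n} (hx : x ∈ solid S)
    (hy : y ∈ solid S) : ‖y - x‖ ≤ Metric.diam (solid S) := by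
  rw [← dist_eq_norm]
  refine Metric.dist_le_diam_of_mem ?_ hy hx
  exact isBounded_convexHull.2 (Set.finite_range _).isBounded

/-- The error functional at the point with lattice coordinates `u` of polynomial interpolation at
the equally spaced points of degree `d`. -/
def errorFunctional (S : Affine.Simplex ℝ (Space n) n) (d : ℕ) (u : Fin (n + 1) → ℝ) :
    Space n →₀ ℂ :=
  single (latticePoint S d u) 1 - ∑ k ∈ Finset.piAntidiag Finset.univ d,
    single (latticePoint S d fun i => k i) (latticeWeight (-1) u k : ℂ)

lemma linearCombination_errorFunctional {V : Type*} [AddCommGroup V] [Module ℂ V]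
    (S : Affine.Simplex ℝ (Space n) n) (d : ℕ) (u : Fin (n + 1) → ℝ) (g : Space n → V) :
    linearCombination ℂ g (errorFunctional S d u) =
      g (latticePoint S d u) - ∑ k ∈ Finset.piAntidiag Finset.univ d,
        (latticeWeight (-1) u k : ℂ) • g (latticePoint S d fun i => k i) := by
  simp [errorFunctional, map_sum]

lemma annihilates_errorFunctional (S : Affine.Simplex ℝ (Space n) n) {d : ℕ}
    {u : Fin (n + 1) → ℝ} (hu : ∑ i, u i = d) : Annihilates (d + 1) (errorFunctional S d u) := by
  intro q hq
  have hpoly : ∀ v : Fin (n + 1) → ℝ, polyEval q (latticePoint S d v) =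
      ∑ a ∈ q.support, q.coeff a *
        ((∏ i, (∑ j, (S.points j i / d) * v j) ^ a i : ℝ) : ℂ) := by
    intro v
    rw [polyEval, MvPolynomial.eval_eq']
    refine Finset.sum_congr rfl fun a _ => ?_
    push_cast
    congr 1
    refine Finset.prod_congr rfl fun i _ => ?_
    congr 1
    simp only [latticePoint, WithLp.ofLp_sum, Finset.sum_apply, WithLp.ofLp_smul,
      Pi.smul_apply, smul_eq_mul]
    push_cast
    exact Finset.sum_congr rfl fun j _ => by ring
  rw [linearCombination_errorFunctional, sub_eq_zero]
  simp_rw [hpoly, smul_eq_mul, Finset.mul_sum]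
  rw [Finset.sum_comm]
  refine Finset.sum_congr rfl fun a ha => ?_
  have := (latticeExact_prod Finset.univ (fun i j => S.points j i / d) a).sum_eq
    (Nat.lt_succ_iff.1 (hq a ha)) hu
  rw [← this]
  push_cast
  rw [Finset.mul_sum]
  exact Finset.sum_congr rfl fun k _ => by ring

/-- The Taylor polynomial of each character about the base point is reproduced exactly, so only
the Taylor remainders contribute. -/
lemma norm_symbol_errorFunctional_le {β : ℝ} (S : Affine.Simplex ℝ (Space n) n) (d : ℕ)
    {u : Fin (n + 1) → ℝ} (hu0 : ∀ i, 0 ≤ u i) (hu : ∑ i, u i = (d + 1 : ℕ))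
    (hx : latticePoint S (d + 1) u ∈ solid S) (ξ : Space n) :
    ‖symbol β (errorFunctional S (d + 1) u) ξ‖ ≤
      2 ^ (2 * d + 1) * ((√(2 * β) * Metric.diam (solid S)) ^ (d + 2) / (d + 2).factorial) *
        ‖ξ‖ ^ (d + 2) := by
  set x := latticePoint S (d + 1) u with hxdef
  set K := Finset.piAntidiag (Finset.univ : Finset (Fin (n + 1))) (d + 1) with hK
  set w : (Fin (n + 1) → ℕ) → ℝ := latticeWeight (-1) u with hw
  let y : (Fin (n + 1) → ℕ) → Space n := fun k => latticePoint S (d + 1) fun i => k i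
  let t : Fin (n + 1) → ℝ := fun j => √(2 * β) * inner ℝ ξ (S.points j - x) / (d + 1 : ℕ)
  let θ : (Fin (n + 1) → ℕ) → ℝ := fun k => √(2 * β) * inner ℝ ξ (y k - x)
  have hd : ((d + 1 : ℕ) : ℝ) ≠ 0 := by positivity
  have hθ : ∀ v : Fin (n + 1) → ℝ, ∑ i, v i = (d + 1 : ℕ) →
      √(2 * β) * inner ℝ ξ (latticePoint S (d + 1) v - x) = ∑ j, t j * v j := by
    intro v hv
    have h1 : latticePoint S (d + 1) v - x =
        ∑ j, (v j / (d + 1 : ℕ)) • (S.points j - x) := by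
      simp_rw [smul_sub, Finset.sum_sub_distrib, ← Finset.sum_smul, ← Finset.sum_div, hv]
      rw [div_self hd, one_smul, latticePoint]
    rw [h1, inner_sum, Finset.mul_sum]
    refine Finset.sum_congr rfl fun j _ => ?_
    rw [inner_smul_right]
    simp only [t]
    ring
  have hθu : ∑ j, t j * u j = 0 := by
    rw [← hθ u hu, ← hxdef, sub_self, inner_zero_right, mul_zero]
  have hθk : ∀ k ∈ K, θ k = ∑ j, t j * (k j : ℝ) := by
    intro k hk
    refine hθ _ ?_
    have : ∑ j, k j = d + 1 := by simpa [hK] using hk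
    exact_mod_cast this
  have hpow : ∀ j ∈ Finset.range (d + 2), ∑ k ∈ K, w k * θ k ^ j = 0 ^ j := by
    intro j hj
    have := (latticeExact_pow t j).sum_eq (Nat.lt_succ_iff.1 (Finset.mem_range.1 hj)) hu
    simp only [hθu] at this
    rw [← this]
    exact Finset.sum_congr rfl fun k hk => by rw [hθk k hk]
  have htaylor : ∑ k ∈ K, (w k : ℂ) * ∑ j ∈ Finset.range (d + 2),
      (θ k * Complex.I) ^ j / (j.factorial : ℂ) = 1 := by
    simp_rw [Finset.mul_sum]
    rw [Finset.sum_comm]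
    have h1 : ∀ j ∈ Finset.range (d + 2), ∑ k ∈ K, (w k : ℂ) *
        ((θ k * Complex.I) ^ j / (j.factorial : ℂ)) =
        Complex.I ^ j / (j.factorial : ℂ) * 0 ^ j := by
      intro j hj
      have h2 : ((∑ k ∈ K, w k * θ k ^ j : ℝ) : ℂ) = 0 ^ j := by
        rw [hpow j hj]
        push_cast
        rfl
      rw [← h2]
      push_cast
      rw [Finset.mul_sum]
      exact Finset.sum_congr rfl fun k _ => by rw [mul_pow]; ring
    rw [Finset.sum_congr rfl h1, Finset.sum_range_succ']
    simp
  have hfeat : ∀ k, feature β (y k) ξ = feature β x ξ * Complex.exp (θ k * Complex.I) := by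
    intro k
    rw [← feature_apply, ← feature_add, add_sub_cancel]
  have hsym : symbol β (errorFunctional S (d + 1) u) ξ =
      -(feature β x ξ * ∑ k ∈ K, (w k : ℂ) * expRemainder (d + 2) (θ k)) := by
    have h1 : symbol β (errorFunctional S (d + 1) u) ξ =
        feature β x ξ - ∑ k ∈ K, (w k : ℂ) * feature β (y k) ξ := by
      rw [symbol, linearCombination_errorFunctional]
      simp [y, hK, hw, hxdef]
    simp only [h1, hfeat, expRemainder, mul_sub, Finset.sum_sub_distrib, htaylor]
    rw [mul_one, Finset.mul_sum, neg_sub]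
    congr 1
    exact Finset.sum_congr rfl fun k _ => by ring
  rw [hsym, norm_neg, norm_mul, norm_feature, one_mul]
  set r := Metric.diam (solid S) with hr
  have hr0 : 0 ≤ r := Metric.diam_nonneg
  have hrem : ∀ k ∈ K, ‖expRemainder (d + 2) (θ k)‖ ≤
      (√(2 * β) * r) ^ (d + 2) / (d + 2).factorial * ‖ξ‖ ^ (d + 2) := by
    intro k hk
    refine (norm_expRemainder_le _ _).trans ?_
    rw [div_mul_eq_mul_div, ← mul_pow]
    gcongr
    have h1 : ‖y k - x‖ ≤ r :=
      norm_sub_le_diam hx (latticePoint_mem_solid S (Nat.succ_ne_zero d) (by simpa [hK] using hk))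
    simp only [θ]
    rw [abs_mul, abs_of_nonneg (Real.sqrt_nonneg _), mul_assoc]
    gcongr
    refine (abs_real_inner_le_norm _ _).trans ?_
    rw [mul_comm]
    gcongr
  calc ‖∑ k ∈ K, (w k : ℂ) * expRemainder (d + 2) (θ k)‖
      ≤ ∑ k ∈ K, |w k| * ((√(2 * β) * r) ^ (d + 2) / (d + 2).factorial * ‖ξ‖ ^ (d + 2)) := by
        refine norm_sum_le_of_le _ fun k hk => ?_
        rw [norm_mul, Complex.norm_real, Real.norm_eq_abs]
        gcongr
        exact hrem k hk
    _ ≤ 2 ^ (2 * d + 1) *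
        ((√(2 * β) * r) ^ (d + 2) / (d + 2).factorial * ‖ξ‖ ^ (d + 2)) := by
        rw [← Finset.sum_mul]
        gcongr
        exact sum_abs_latticeWeight_le d hu0 (by rw [hu]; push_cast; ring)
    _ = _ := by ring

lemma norm_embed_errorFunctional_le {β : ℝ} (S : Affine.Simplex ℝ (Space n) n) (d : ℕ)
    {u : Fin (n + 1) → ℝ} (hu0 : ∀ i, 0 ≤ u i) (hu : ∑ i, u i = (d + 1 : ℕ))
    (hx : latticePoint S (d + 1) u ∈ solid S) :
    ‖embed β (errorFunctional S (d + 1) u)‖ ≤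
      2 ^ (2 * d + 1) * ((√(2 * β) * Metric.diam (solid S)) ^ (d + 2) / (d + 2).factorial) *
        √((d + 2).factorial * 4 ^ (d + 2) * √2 ^ n) := by
  have hr0 : 0 ≤ Metric.diam (solid S) := Metric.diam_nonneg
  set A := 2 ^ (2 * d + 1) *
    ((√(2 * β) * Metric.diam (solid S)) ^ (d + 2) / (d + 2).factorial) with hA
  have hA0 : 0 ≤ A := by positivity
  refine le_of_sq_le_sq ?_ (by positivity)
  rw [mul_pow, Real.sq_sqrt (by positivity), norm_embed_sq]
  obtain ⟨hi, hle⟩ := integral_norm_pow_stdGaussian_le n (d + 2)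
  refine le_trans ?_ (mul_le_mul_of_nonneg_left hle (sq_nonneg A))
  rw [← integral_const_mul]
  refine integral_mono_of_nonneg (.of_forall fun ξ => by positivity) (hi.const_mul _)
    (.of_forall fun ξ => ?_)
  simp only
  rw [← mul_pow]
  gcongr
  exact norm_symbol_errorFunctional_le S d hu0 hu hx ξ

/-- The error estimate for an arbitrary degree `d + 1` of the equally spaced points. -/
lemma norm_sub_le_of_equallySpaced {β : ℝ} (hβ : 0 < β) {m : ℕ} {f s : Space n → ℂ}
    (hf : Continuous f) {C : ℝ} (hC : IsNativeBound (gaussian n β) m f C) {X : Finset (Space n)}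
    (hs : IsSplineInterpolant (gaussian n β) m X f s) (S : Affine.Simplex ℝ (Space n) n) (d : ℕ)
    (hm : m ≤ d + 2) (hX : equallySpaced S (d + 1) ⊆ (X : Set (Space n))) {x : Space n}
    (hx : x ∈ solid S) :
    ‖f x - s x‖ ≤ C * (2 ^ (2 * d + 1) *
      ((√(2 * β) * Metric.diam (solid S)) ^ (d + 2) / (d + 2).factorial) *
        √((d + 2).factorial * 4 ^ (d + 2) * √2 ^ n)) := by
  obtain ⟨u, hu0, hu, rfl⟩ := exists_latticePoint hx (Nat.succ_ne_zero d)
  have hann : Annihilates m (errorFunctional S (d + 1) u) := fun q hq =>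
    annihilates_errorFunctional S hu q fun a ha => (hq a ha).trans_le hm
  have h := hs.norm_apply_sub_le hβ hf hC hann
  have hfs : ∀ y ∈ X, s y = f y := hs.choose_spec.choose_spec.2.2.2
  have h0 : ∑ k ∈ Finset.piAntidiag Finset.univ (d + 1), (latticeWeight (-1) u k : ℂ) •
      (f - s) (latticePoint S (d + 1) fun i => k i) = 0 := by
    refine Finset.sum_eq_zero fun k hk => ?_
    rw [Pi.sub_apply, hfs _ (hX (latticePoint_mem_equallySpaced S (by simpa using hk))), sub_self,
      smul_zero]
  rw [linearCombination_errorFunctional, h0, sub_zero] at h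
  exact h.trans (mul_le_mul_of_nonneg_left (norm_embed_errorFunctional_le S d hu0 hu hx) hC.1)

end

/-! ### Comparison of the constants -/

section

lemma unitBallVolume_odd (j : ℕ) : unitBallVolume (2 * j + 1) =
    Real.pi ^ j * 2 ^ (j + 1) / ((2 * j + 1).doubleFactorial : ℝ) := by
  rw [unitBallVolume, measureReal_def,
    InnerProductSpace.volume_ball_of_dim_odd (k := j) (by simp)]
  simp only [finrank_euclideanSpace, Fintype.card_fin, ENNReal.ofReal_one, one_pow, one_mul]
  exact ENNReal.toReal_ofReal (by positivity)

lemma unitBallVolume_even (j : ℕ) : unitBallVolume (2 * j + 2) =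
    Real.pi ^ (j + 1) / ((j + 1).factorial : ℝ) := by
  rw [unitBallVolume, measureReal_def,
    InnerProductSpace.volume_ball_of_dim_even (k := j + 1) (by simp; ring)]
  simp only [ENNReal.ofReal_one, one_pow, one_mul]
  exact ENNReal.toReal_ofReal (by positivity)

lemma doubleFactorial_odd_le (j : ℕ) :
    (2 * j + 1).doubleFactorial ≤ (2 * j + 1) * (2 ^ j * j.factorial) := by
  induction j with
  | zero => simp
  | succ j ih =>
    rw [show 2 * (j + 1) + 1 = 2 * j + 1 + 2 by ring, Nat.doubleFactorial_add_two,
      Nat.factorial_succ]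
    refine Nat.mul_le_mul_left _ (ih.trans ?_)
    calc (2 * j + 1) * (2 ^ j * j.factorial) ≤ (2 * (j + 1)) * (2 ^ j * j.factorial) := by
          gcongr; omega
      _ = _ := by ring

lemma rho_pos : 0 < rho := by unfold rho; positivity

lemma one_le_pi_mul_rho : 1 ≤ Real.pi * rho := by
  unfold rho
  rw [← mul_div_assoc, le_div_iff₀ (Real.exp_pos 1)]
  have h1 := Real.exp_one_lt_d9
  have h2 := Real.pi_gt_three
  have h3 : (1 : ℝ) ≤ √3 := Real.one_le_sqrt.2 (by norm_num)
  nlinarith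

lemma rpow_quarter_sq {a : ℝ} (ha : 0 ≤ a) (x : ℝ) : (a ^ (x / 4)) ^ 2 = a ^ (x / 2) := by
  rw [← Real.rpow_natCast, ← Real.rpow_mul ha]
  congr 1
  push_cast
  ring

/-- A lower bound for `Δ''`, with `j = ⌊(n - 1) / 2⌋` in both parities; `1 / j!` comes from the
volume of the unit ball. -/
lemma Delta_bound {n : ℕ} (hn : 1 ≤ n) :
    0 < Delta n ∧ 4 * √2 ^ n ≤ Delta n ^ 2 * (((n - 1) / 2).factorial : ℝ) := by
  have hpi := Real.pi_pos
  have hpi3 := Real.pi_gt_three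
  have hrho := rho_pos
  have htwo : √2 ^ n = (2 : ℝ) ^ ((n : ℝ) / 2) := by
    rw [Real.sqrt_eq_rpow, ← Real.rpow_natCast, ← Real.rpow_mul (by norm_num)]
    congr 1
    ring
  rcases Nat.even_or_odd n with he | ho
  · obtain ⟨j, rfl⟩ : ∃ j, n = 2 * j + 2 := by
      obtain ⟨k, rfl⟩ := he
      exact ⟨k - 1, by omega⟩
    have hvol : ((2 * j + 2 : ℕ) : ℝ) * unitBallVolume (2 * j + 2) =
        2 * Real.pi ^ (j + 1) / (j.factorial : ℝ) := by
      rw [unitBallVolume_even, Nat.factorial_succ]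
      push_cast
      field_simp
    have hD : Delta (2 * j + 2) = _ := if_neg (Nat.not_odd_iff_even.2 he)
    rw [hvol] at hD
    refine ⟨by rw [hD]; positivity, ?_⟩
    rw [show (2 * j + 2 - 1) / 2 = j by omega, htwo, hD]
    simp only [mul_pow]
    rw [Real.sq_sqrt (by positivity), rpow_quarter_sq hpi.le, rpow_quarter_sq (by norm_num),
      rpow_quarter_sq hrho.le]
    have e1 : Real.pi ^ ((((2 * j + 2 : ℕ) : ℝ) - 1) / 2) = Real.pi ^ j * √Real.pi := by
      rw [Real.sqrt_eq_rpow, ← Real.rpow_natCast, ← Real.rpow_add hpi]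
      congr 1
      push_cast
      ring
    have e2 : (2 : ℝ) ^ ((((2 * j + 2 : ℕ) : ℝ) + 1) / 2) =
        (2 : ℝ) ^ (((2 * j + 2 : ℕ) : ℝ) / 2) * √2 := by
      rw [Real.sqrt_eq_rpow, ← Real.rpow_add (by norm_num)]
      congr 1
      ring
    have e3 : rho ^ ((((2 * j + 2 : ℕ) : ℝ) - 2) / 2) = rho ^ j := by
      rw [← Real.rpow_natCast]
      congr 1
      push_cast
      ring
    rw [e1, e2, e3]
    set T := (2 : ℝ) ^ (((2 * j + 2 : ℕ) : ℝ) / 2) with hT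
    have hT0 : 0 < T := by positivity
    have h1 : 1 ≤ (Real.pi * rho) ^ j := one_le_pow₀ one_le_pi_mul_rho
    have h2 : (1 : ℝ) ≤ √2 := Real.one_le_sqrt.2 (by norm_num)
    have h3 : 1 ≤ √Real.pi := Real.one_le_sqrt.2 (by linarith)
    have h4 : 3 ≤ Real.pi ^ (j + 1) :=
      hpi3.le.trans (le_self_pow₀ (by linarith) (Nat.succ_ne_zero j))
    calc 4 * T ≤ 1 * 1 * 1 * (2 * 3) * T := by linarith
      _ ≤ (Real.pi * rho) ^ j * √Real.pi * √2 * (2 * Real.pi ^ (j + 1)) * T := by gcongr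
      _ = _ := by
        rw [mul_pow]
        field_simp
  · have ho' := ho
    obtain ⟨j, rfl⟩ := ho
    have hvol : ((2 * j + 1 : ℕ) : ℝ) * unitBallVolume (2 * j + 1) =
        (2 * j + 1 : ℕ) * (Real.pi ^ j * 2 ^ (j + 1)) / ((2 * j + 1).doubleFactorial : ℝ) := by
      rw [unitBallVolume_odd, ← mul_div_assoc]
    have hD : Delta (2 * j + 1) = _ := if_pos ho'
    have hdf : 0 < ((2 * j + 1).doubleFactorial : ℝ) := by
      exact_mod_cast Nat.doubleFactorial_pos _
    have hvol0 : 0 < ((2 * j + 1 : ℕ) : ℝ) * unitBallVolume (2 * j + 1) := by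
      rw [hvol]; positivity
    have hvol1 : 2 ≤ ((2 * j + 1 : ℕ) : ℝ) * unitBallVolume (2 * j + 1) * (j.factorial : ℝ) := by
      rw [hvol, div_mul_eq_mul_div, le_div_iff₀ hdf]
      have h1 : ((2 * j + 1).doubleFactorial : ℝ) ≤ (2 * j + 1 : ℕ) * (2 ^ j * j.factorial) := by
        exact_mod_cast doubleFactorial_odd_le j
      have h2 : 1 ≤ Real.pi ^ j := one_le_pow₀ (by linarith)
      calc 2 * ((2 * j + 1).doubleFactorial : ℝ)
          ≤ 2 * ((2 * j + 1 : ℕ) * (2 ^ j * j.factorial)) * 1 := by linarith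
        _ ≤ 2 * ((2 * j + 1 : ℕ) * (2 ^ j * j.factorial)) * Real.pi ^ j := by gcongr
        _ = _ := by ring
    refine ⟨by rw [hD]; positivity, ?_⟩
    rw [show (2 * j + 1 - 1) / 2 = j by omega, htwo, hD]
    simp only [mul_pow]
    rw [Real.sq_sqrt hvol0.le, Real.sq_sqrt (by positivity), rpow_quarter_sq hpi.le,
      rpow_quarter_sq (by norm_num), rpow_quarter_sq hrho.le]
    have e1 : ∀ a : ℝ, a ^ ((((2 * j + 1 : ℕ) : ℝ) - 1) / 2) = a ^ j := by
      intro a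
      rw [← Real.rpow_natCast]
      congr 1
      push_cast
      ring
    rw [e1, e1]
    set T := (2 : ℝ) ^ (((2 * j + 1 : ℕ) : ℝ) / 2) with hT
    set V := ((2 * j + 1 : ℕ) : ℝ) * unitBallVolume (2 * j + 1) with hV
    have hT0 : 0 < T := by positivity
    have h1 : 1 ≤ (Real.pi * rho) ^ j := one_le_pow₀ one_le_pi_mul_rho
    have h2 : 2 ≤ 2 + 1 / Real.exp 1 := by
      have : 0 < 1 / Real.exp 1 := by positivity
      linarith
    calc 4 * T = 2 * 1 * 2 * T := by ring
      _ ≤ (2 + 1 / Real.exp 1) * (Real.pi * rho) ^ j * (V * j.factorial) * T := by gcongr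
      _ = _ := by rw [mul_pow]; ring

lemma mul_add_two_le (l : ℕ) : (l : ℝ) * (l + 2) ≤ 4 * 2 ^ l := by
  have h : l * (l + 2) ≤ 4 * 2 ^ l := by
    have hl := Nat.lt_two_pow_self (n := l)
    induction l with
    | zero => simp
    | succ l ih =>
      have := ih Nat.lt_two_pow_self
      have h2 := Nat.lt_two_pow_self (n := l)
      rw [pow_succ]
      nlinarith
  exact_mod_cast h

lemma sqrt_self_pow_le (l : ℕ) : √((l : ℝ) ^ l) ≤ (5 / 3) ^ l * √(l.factorial : ℝ) := by
  have h1 := Real.pow_div_factorial_le_exp (l : ℝ) (by positivity) l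
  rw [div_le_iff₀ (by positivity), ← mul_one (l : ℝ), Real.exp_nat_mul, mul_one] at h1
  have h2 : Real.exp 1 ≤ (5 / 3) ^ 2 := by
    have := Real.exp_one_lt_d9
    norm_num at this ⊢
    linarith
  rw [Real.sqrt_le_left (by positivity), mul_pow, Real.sq_sqrt (by positivity), ← pow_mul,
    mul_comm l 2, pow_mul]
  refine h1.trans ?_
  gcongr

lemma factorial_half_le {j l : ℕ} (h : 2 * j ≤ l + 2) :
    (j.factorial : ℝ) ≤ (l + 2) * √(l.factorial : ℝ) := by
  refine le_of_sq_le_sq ?_ (by positivity)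
  rw [mul_pow, Real.sq_sqrt (by positivity)]
  have h1 : j.factorial * j.factorial ≤ (l + 2).factorial :=
    (Nat.le_of_dvd (Nat.factorial_pos _) (Nat.factorial_mul_factorial_dvd_factorial_add j j)).trans
      (Nat.factorial_le (by omega))
  have h2 : (l + 2).factorial ≤ (l + 2) ^ 2 * l.factorial := by
    rw [Nat.factorial_succ, Nat.factorial_succ, ← mul_assoc, sq]
    gcongr
    omega
  rw [sq]
  exact_mod_cast h1.trans h2

/-- The dimension-dependent part of the comparison of constants, squared. Here `550` is a lower
bound for `√41472 · e`, the constant that `c₂` contributes; `l ^ (l / 2)` costs a factor `(5 / 3) ^ l`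
and the powers of `l` a factor `2 ^ l`, and `128 · 5 / 3 · 2 < 550`. -/
lemma dimension_bound {n l : ℕ} (hn : 1 ≤ n) (hnl : 2 * ((n - 1) / 2) ≤ l + 2) :
    128 ^ l * √2 ^ n * (16 * Real.pi * l) * √((l : ℝ) ^ l) ≤
      64 * l.factorial * Delta n ^ 2 * 550 ^ l := by
  obtain ⟨-, hD⟩ := Delta_bound hn
  set j := (n - 1) / 2 with hj
  have hpi := Real.pi_le_four
  have hpi0 := Real.pi_pos
  have h1 : √2 ^ n ≤ Delta n ^ 2 * ((l + 2) * √(l.factorial : ℝ)) / 4 := by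
    rw [le_div_iff₀ (by norm_num), mul_comm]
    exact hD.trans (by gcongr; exact factorial_half_le hnl)
  calc 128 ^ l * √2 ^ n * (16 * Real.pi * l) * √((l : ℝ) ^ l)
      ≤ 128 ^ l * (Delta n ^ 2 * ((l + 2) * √(l.factorial : ℝ)) / 4) * (16 * 4 * l) *
          ((5 / 3) ^ l * √(l.factorial : ℝ)) := by
        gcongr
        exact sqrt_self_pow_le l
    _ = 16 * Delta n ^ 2 * (√(l.factorial : ℝ) * √(l.factorial : ℝ)) * (l * (l + 2)) *
          (128 * (5 / 3)) ^ l := by rw [mul_pow]; ring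
    _ ≤ 16 * Delta n ^ 2 * l.factorial * (4 * 2 ^ l) * (128 * (5 / 3)) ^ l := by
        rw [Real.mul_self_sqrt (by positivity)]
        exact mul_le_mul_of_nonneg_right
          (mul_le_mul_of_nonneg_left (mul_add_two_le l) (by positivity)) (by positivity)
    _ = 64 * l.factorial * Delta n ^ 2 * (2 * (128 * (5 / 3))) ^ l := by rw [mul_pow 2]; ring
    _ ≤ _ := by gcongr; norm_num

lemma rho3_pow_four {β : ℝ} (hβ : 0 < β) : rho3 β ^ 4 = 12 * (Real.exp 1 * β) ^ 2 := by
  unfold rho3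
  rw [mul_pow, ← Real.rpow_natCast ((12 : ℝ) ^ (1 / 4 : ℝ)), ← Real.rpow_mul (by norm_num),
    show √(Real.exp 1 * β) ^ 4 = (√(Real.exp 1 * β) ^ 2) ^ 2 by ring, Real.sq_sqrt (by positivity)]
  norm_num

lemma const2_eq {β : ℝ} (hβ : 0 < β) (b₀ : ℝ) :
    const2 β b₀ = 41472 * (Real.exp 1 * β) ^ 2 * b₀ ^ 3 := by
  rw [const2, rho3_pow_four hβ]
  ring

lemma const2_pos {β b₀ : ℝ} (hβ : 0 < β) (hb₀ : 0 < b₀) : 0 < const2 β b₀ := by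
  rw [const2_eq hβ]; positivity

lemma delta0_eq (β b₀ : ℝ) : delta0 β b₀ = min b₀ (1 / const2 β b₀) := rfl

lemma const1_pos {n : ℕ} (hn : 1 ≤ n) {b₀ : ℝ} (hb₀ : 0 < b₀) : 0 < const1 n b₀ := by
  have := (Delta_bound hn).1
  unfold const1
  positivity

/-- The bound `c₁ √δ (c₂ δ)^{c₃ / δ}` does not increase when `δ` is replaced by `b₀ / l`. -/
lemma bound_at_degree_le {n : ℕ} (hn : 1 ≤ n) {β b₀ δ : ℝ} (hβ : 0 < β) (hb₀ : 0 < b₀)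
    (hδ : 0 < δ) (hδ' : const2 β b₀ * δ ≤ 1) {l : ℕ} (hl : 0 < l) (hl' : b₀ / δ ≤ l) :
    Delta n * (1 / √(16 * Real.pi)) * (1 / √l) * (const2 β b₀ * (b₀ / l)) ^ ((l : ℝ) / 4) ≤
      const1 n b₀ * √δ * (const2 β b₀ * δ) ^ (const3 b₀ / δ) := by
  have hD := (Delta_bound hn).1
  have hc := const2_pos hβ hb₀
  have hl0 : (0 : ℝ) < l := by exact_mod_cast hl
  have hbl : b₀ / l ≤ δ := by
    rw [div_le_iff₀ hδ] at hl'
    rw [div_le_iff₀ hl0]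
    linarith
  have h1 : 1 / √l ≤ 1 / √b₀ * √δ := by
    rw [div_mul_eq_mul_div, one_mul, ← Real.sqrt_div' _ hb₀.le, ← Real.sqrt_one,
      ← Real.sqrt_div' _ hl0.le]
    apply Real.sqrt_le_sqrt
    rw [div_le_div_iff₀ hl0 hb₀]
    rw [div_le_iff₀ hl0] at hbl
    linarith
  have h2 : (const2 β b₀ * (b₀ / l)) ^ ((l : ℝ) / 4) ≤
      (const2 β b₀ * δ) ^ (const3 b₀ / δ) := by
    refine (Real.rpow_le_rpow (by positivity) (mul_le_mul_of_nonneg_left hbl hc.le)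
      (by positivity)).trans ?_
    refine Real.rpow_le_rpow_of_exponent_ge (by positivity) hδ' ?_
    rw [const3, div_right_comm]
    linarith
  unfold const1
  calc _ ≤ Delta n * (1 / √(16 * Real.pi)) * (1 / √b₀ * √δ) *
        (const2 β b₀ * δ) ^ (const3 b₀ / δ) := by gcongr
    _ = _ := by ring

/-- The interpolation error bound of degree `d + 1`, that is `l = d + 2`, lies below the value
of `c₁ √δ (c₂ δ)^{c₃ / δ}` at `δ = b₀ / l`. -/
lemma degree_bound_le {n : ℕ} (hn : 1 ≤ n) {β b₀ r : ℝ} (hβ : 0 < β) (hb₀ : 0 < b₀)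
    (hr0 : 0 ≤ r) (hr : r ≤ b₀) {d : ℕ} (hnl : 2 * ((n - 1) / 2) ≤ d + 2 + 2) :
    2 ^ (2 * d + 1) * ((√(2 * β) * r) ^ (d + 2) / (d + 2).factorial) *
        √((d + 2).factorial * 4 ^ (d + 2) * √2 ^ n) ≤
      Delta n * (1 / √(16 * Real.pi)) * (1 / √(d + 2 : ℕ)) *
        (const2 β b₀ * (b₀ / (d + 2 : ℕ))) ^ (((d + 2 : ℕ) : ℝ) / 4) := by
  have hdim := dimension_bound hn hnl
  have h64 : (2 : ℝ) ^ (2 * (2 * d + 1)) * 64 = 16 ^ (d + 2) := by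
    rw [show (16 : ℝ) = 2 ^ 4 by norm_num, show (64 : ℝ) = 2 ^ 6 by norm_num, ← pow_mul, ← pow_add]
    congr 1
    ring
  have hD := (Delta_bound hn).1
  have hpi := Real.pi_pos
  have hc := const2_pos hβ hb₀
  have hl0 : (0 : ℝ) < (d + 2 : ℕ) := by positivity
  generalize hl : d + 2 = l at *
  refine le_of_sq_le_sq ?_ (by positivity)
  have hL : (2 ^ (2 * d + 1) * ((√(2 * β) * r) ^ l / l.factorial) *
      √(l.factorial * 4 ^ l * √2 ^ n)) ^ 2 =
      (128 ^ l * √2 ^ n) * (β * r ^ 2) ^ l / (64 * l.factorial) := by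
    rw [mul_pow, mul_pow, Real.sq_sqrt (by positivity), div_pow, ← pow_mul (√(2 * β) * r),
      mul_comm l 2, pow_mul (√(2 * β) * r), mul_pow (√(2 * β)), Real.sq_sqrt (by positivity),
      ← pow_mul (2 : ℝ), mul_comm (2 * d + 1) 2, eq_div_iff (by positivity)]
    have : (128 : ℝ) ^ l = 16 ^ l * 2 ^ l * 4 ^ l := by
      rw [← mul_pow, ← mul_pow]; norm_num
    rw [this, ← h64, mul_assoc 2 β, mul_pow 2 (β * r ^ 2)]
    field_simp
  have hR : (Delta n * (1 / √(16 * Real.pi)) * (1 / √l) *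
      (const2 β b₀ * (b₀ / l)) ^ ((l : ℝ) / 4)) ^ 2 =
      Delta n ^ 2 * ((√41472 * Real.exp 1) ^ l * (β * b₀ ^ 2) ^ l) /
        (16 * Real.pi * l * √((l : ℝ) ^ l)) := by
    have h1 : (const2 β b₀ * (b₀ / l)) ^ ((l : ℝ) / 2) =
        ((√41472 * Real.exp 1) ^ l * (β * b₀ ^ 2) ^ l) / √((l : ℝ) ^ l) := by
      have h2 : const2 β b₀ * (b₀ / l) =
          (√41472 * Real.exp 1 * (β * b₀ ^ 2)) ^ 2 / l := by
        rw [const2_eq hβ, mul_pow (√41472 * Real.exp 1), mul_pow (√41472),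
          Real.sq_sqrt (by norm_num)]
        ring
      rw [h2, div_eq_mul_one_div (l : ℝ), mul_comm (l : ℝ), Real.rpow_mul (by positivity),
        ← Real.sqrt_eq_rpow, Real.rpow_natCast, Real.sqrt_div' _ hl0.le,
        Real.sqrt_sq (by positivity), div_pow, ← mul_pow]
      congr 1
      refine (Real.sqrt_eq_iff_mul_self_eq (by positivity) (by positivity)).2 ?_ |>.symm
      rw [← mul_pow, Real.mul_self_sqrt hl0.le]
    rw [mul_pow, rpow_quarter_sq (by positivity), h1]
    simp only [mul_pow, div_pow, one_pow]
    rw [Real.sq_sqrt (by positivity), Real.sq_sqrt (by positivity)]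
    field_simp
  rw [hL, hR, div_le_div_iff₀ (by positivity) (by positivity)]
  have h550 : 550 ≤ √41472 * Real.exp 1 := by
    have h1 : (203 : ℝ) ≤ √41472 := Real.le_sqrt_of_sq_le (by norm_num)
    have h2 := Real.exp_one_gt_d9
    nlinarith
  calc 128 ^ l * √2 ^ n * (β * r ^ 2) ^ l * (16 * Real.pi * l * √((l : ℝ) ^ l))
      = (128 ^ l * √2 ^ n * (16 * Real.pi * l) * √((l : ℝ) ^ l)) * (β * r ^ 2) ^ l := by ring
    _ ≤ (64 * l.factorial * Delta n ^ 2 * (√41472 * Real.exp 1) ^ l) * (β * b₀ ^ 2) ^ l := by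
        refine mul_le_mul (hdim.trans ?_) ?_ (by positivity) (by positivity) <;> gcongr
    _ = _ := by ring

end

end GaussianInterpolation

end

theorem theorem2p4 (β b₀ : ℝ) (hβ : 0 < β) (hb₀ : 0 < b₀) :
    0 < GaussianInterpolation.delta0 β b₀ ∧
    0 < GaussianInterpolation.const2 β b₀ ∧
    0 < GaussianInterpolation.const3 b₀ ∧
    ∀ n : ℕ, 1 ≤ n →
      0 < GaussianInterpolation.const1 n b₀ ∧
      ∀ (m : ℕ) (f s : GaussianInterpolation.Space n → ℂ)
        (X : Finset (GaussianInterpolation.Space n)) (δ : ℝ),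
        GaussianInterpolation.InNativeSpace (GaussianInterpolation.gaussian n β) m f →
        GaussianInterpolation.IsSplineInterpolant (GaussianInterpolation.gaussian n β) m X f s →
        0 < δ → δ ≤ GaussianInterpolation.delta0 β b₀ →
        (m : ℝ) ≤ 2 * b₀ / δ →
        (Odd n → (n : ℝ) - 3 ≤ 2 * b₀ / δ) →
        (Even n → (n : ℝ) - 4 ≤ 2 * b₀ / δ) →
        ∀ (Ω : Set (GaussianInterpolation.Space n)) (x : GaussianInterpolation.Space n),
          x ∈ Ω → GaussianInterpolation.HasCentersAt X b₀ δ Ω x →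
          ‖f x - s x‖ ≤
            GaussianInterpolation.const1 n b₀ * √δ *
              (GaussianInterpolation.const2 β b₀ * δ) ^ (GaussianInterpolation.const3 b₀ / δ) *
              GaussianInterpolation.nativeNorm (GaussianInterpolation.gaussian n β) m f := by
  open GaussianInterpolation in
  have hc2 := const2_pos hβ hb₀
  refine ⟨?_, hc2, by unfold const3; positivity, fun n hn => ⟨const1_pos hn hb₀, ?_⟩⟩
  · rw [delta0_eq]
    exact lt_min hb₀ (by positivity)
  intro m f s X δ hf hs hδ hδ0 hm hodd heven Ω x _ hcent
  obtain ⟨r, -, hr, S, hdiam, hxS, -, hcent⟩ := hcent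
  rw [delta0_eq] at hδ0
  have hδb : δ ≤ b₀ := hδ0.trans (min_le_left _ _)
  have hδc : const2 β b₀ * δ ≤ 1 := by
    have := hδ0.trans (min_le_right _ _)
    rwa [le_div_iff₀ hc2, mul_comm] at this
  have ht : 1 ≤ b₀ / δ := (one_le_div hδ).2 hδb
  -- The largest admissible `l` dominates `m` and the dimension.
  have hfloor : ∀ k : ℕ, (k : ℝ) ≤ 2 * b₀ / δ → k ≤ ⌊2 * b₀ / δ⌋₊ := fun k => Nat.le_floor
  have h2t : 2 * b₀ / δ = 2 * (b₀ / δ) := mul_div_assoc _ _ _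
  have hl2 : 2 ≤ ⌊2 * b₀ / δ⌋₊ := hfloor 2 (by push_cast; linarith)
  have hle : (⌊2 * b₀ / δ⌋₊ : ℝ) ≤ 2 * b₀ / δ := Nat.floor_le (by positivity)
  have hge : b₀ / δ ≤ (⌊2 * b₀ / δ⌋₊ : ℝ) := by
    have := Nat.lt_floor_add_one (2 * b₀ / δ)
    linarith
  have hml := hfloor m hm
  have hnl : 2 * ((n - 1) / 2) ≤ ⌊2 * b₀ / δ⌋₊ + 2 := by
    rcases Nat.even_or_odd n with he | ho
    · have h1 := hfloor (n - 4) (by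
        rcases le_total 4 n with h | h
        · rw [Nat.cast_sub h]; exact_mod_cast heven he
        · rw [Nat.sub_eq_zero_of_le h]; push_cast; positivity)
      obtain ⟨k, rfl⟩ := he
      omega
    · have h1 := hfloor (n - 3) (by
        rcases le_total 3 n with h | h
        · rw [Nat.cast_sub h]; exact_mod_cast hodd ho
        · rw [Nat.sub_eq_zero_of_le h]; push_cast; positivity)
      obtain ⟨k, rfl⟩ := ho
      omega
  obtain ⟨d, hd⟩ : ∃ d, ⌊2 * b₀ / δ⌋₊ = d + 2 := ⟨_, (Nat.sub_add_cancel hl2).symm⟩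
  have hX := hcent _ hl2 hge hle
  rw [hd] at hX hge hml hnl
  have hbound := (degree_bound_le hn hβ hb₀ (hdiam ▸ Metric.diam_nonneg) hr hnl).trans
    (bound_at_degree_le hn hβ hb₀ hδ hδc (Nat.succ_pos _) hge)
  set E := const1 n b₀ * √δ * (const2 β b₀ * δ) ^ (const3 b₀ / δ) with hE
  have hE0 : 0 < E := by
    have := const1_pos hn hb₀
    positivity
  -- Every admissible constant `C` gives the estimate, and `nativeNorm` is their infimum.
  rw [← div_le_iff₀' hE0]
  refine le_csInf hf.2 fun C hC => ?_
  rw [div_le_iff₀ hE0]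
  refine (norm_sub_le_of_equallySpaced hβ hf.1 hC hs S d hml hX hxS).trans ?_
  rw [hdiam]
  exact mul_le_mul_of_nonneg_left hbound hC.1
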